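/- Setting. In the plane there are two fixed centers of mass $1$, $Q_1=(-\chi,0)$ and $Q_2=(0,0)$, and two particles $Q_3,Q_4$ of mass $\mu$, all interacting by Newtonian attraction. In terms of velocities $v_i=\dot Q_i$ the motion is governed by the Hamiltonian (divided by $\mu$) $$H=\frac{|v_3|^2}{2}+\frac{|v_4|^2}{2}-\frac1{|Q_3|}-\frac1{|Q_4|}-\frac1{|Q_3-Q_1|}-\frac1{|Q_4-Q_1|}-\frac{\mu}{|Q_3-Q_4|}.$$ Put $Q_-=\frac{Q_3-Q_4}{2}$, $v_-=v_3-v_4$, and write $x\times y=x_1y_2-x_2y_1$. Fix $\frac13<\kappa<\frac12$ and $K>0$. We consider collision-free orbits which at a time $t^-$ lie on the sphere $|Q_3-Q_4|=\mu^\kappa$, have zero total energy $H=0$, satisfy $-K\le \frac{|v_3|^2}{2}-\frac1{|Q_3|}\le-\frac1K$ and $|Q_3|\ge \frac1K$ at $t^-$ ($Q_3$ is captured by $Q_2$ and the encounter takes place away from $Q_2$). An inner arc is such an orbit on a time interval $[t^-,T]$, $T\ge t^-$, during which $|Q_3-Q_4|\le\mu^\kappa$; a passage is an inner arc with $T=t^+>t^-$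 and $|Q_3-Q_4|=\mu^\kappa$ again at time $t^+$. Superscripts $\mp$ denote values at $t^\mp$. At each time of an inner arc define $$\frac1{4\mathcal L_{in}^2}=\frac{|v_-|^2}{4}-\frac{\mu}{2|Q_-|}\ (\mathcal L_{in}>0),\qquad G_{in}=v_-\times Q_-,\qquad \alpha=\pi+2\arctan\Big(\frac{G_{in}}{\mu\mathcal L_{in}}\Big)\in(0,2\pi),$$ and let $R(\alpha)$ be the rotation by the angle $\alpha$. Lemma. For all sufficiently small $\mu>0$ and all sufficiently large $\chi$ the following holds. The smallness and largeness thresholds and the constants implied in $O(\cdot)$ depend only on $\kappa$ and $K$, and, where a $\theta_0$ occurs, on $\theta_0$. (a) For every passage, with $\alpha$ evaluated at any time of $[t^-,t^+]$, $$v_3^+=\tfrac12R(\alpha)(v_3^--v_4^-)+\tfrac12(v_3^-+v_4^-)+O\big(\mu^{(1-2\kappa)/3}+\mu^{3\kappa-1}\big),$$ $$v_4^+=-\tfrac12R(\alpha)(v_3^--v_4^-)+\tfrac12(v_3^-+v_4^-)+O\big(\mu^{(1-2\kappa)/3}+\mu^{3\kappa-1}\big),$$ $$Q_3^++Q_4^+=Q_3^-+Q_4^-+O(\mu^\kappa).$$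 (b) Along every inner arc $\frac{|v_-|^2}{4}-\frac{\mu}{2|Q_-|}>0$ and $\mathcal L_{in}=O(1)$. For every $\theta_0>0$ there is $\delta>0$, depending only on $\kappa,K,\theta_0$, such that: if at some time of an inner arc $\theta_0\le\alpha\le2\pi-\theta_0$, then $G_{in}=O(\mu)$ along the whole arc, and, if the arc is a passage, $|Q_3-Q_4|\le\mu/\delta$ at some time of it; if at some time of an inner arc $|\alpha-\pi|\ge\theta_0$, then $|Q_3-Q_4|\ge\delta\mu$ along the whole arc. (c) For every $\theta_0>0$: if $\theta_0\le\alpha\le2\pi-\theta_0$ at some time of a passage, then the angle between $-Q_-^-$ and $v_-^-$ and the angle between $Q_-^+$ and $v_-^+$ are $O(\mu^{1-\kappa})$. (d) Every inner arc has time length $T-t^-=O(\mu^\kappa)$; in particular $t^+-t^-=O(\mu^\kappa)$ for every passage. -/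

import Mathlib

open Real Set

noncomputable section

namespace TwoCenterTwoBody

/-- The Euclidean plane. -/
abbrev Plane := EuclideanSpace ℝ (Fin 2)

/-- The fixed centre `Q₁ = (-χ, 0)`; the other fixed centre `Q₂` is the origin. -/
def center₁ (χ : ℝ) : Plane := !₂[-χ, 0]

/-- The Newtonian attraction exerted on the point `q` by a unit mass located at `c`. -/
def attraction (q c : Plane) : Plane := (‖c - q‖ ^ 3)⁻¹ • (c - q)

/-- The planar cross product `x × y`. -/
def cross (x y : Plane) : ℝ := x 0 * y 1 - x 1 * y 0

/-- The rotation `R(α)` of the plane. -/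
def rot (α : ℝ) (x : Plane) : Plane :=
  !₂[cos α * x 0 - sin α * x 1, sin α * x 0 + cos α * x 1]

/-- The Hamiltonian of the two-centre-two-body problem (masses `1, 1, μ, μ`), divided by `μ`
and written in terms of the velocities `vᵢ = Pᵢ / μ`. -/
def hamiltonian (μ χ : ℝ) (Q₃ Q₄ v₃ v₄ : Plane) : ℝ :=
  ‖v₃‖ ^ 2 / 2 + ‖v₄‖ ^ 2 / 2 - 1 / ‖Q₃‖ - 1 / ‖Q₄‖
    - 1 / ‖Q₃ - center₁ χ‖ - 1 / ‖Q₄ - center₁ χ‖ - μ / ‖Q₃ - Q₄‖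

/-- Positions and velocities of the two light particles, as functions of time. -/
structure Motion where
  Q₃ : ℝ → Plane
  Q₄ : ℝ → Plane
  v₃ : ℝ → Plane
  v₄ : ℝ → Plane

namespace Motion

/-- The relative position `Q₋ = (Q₃ - Q₄) / 2`. -/
def Qrel (m : Motion) (t : ℝ) : Plane := (1 / 2 : ℝ) • (m.Q₃ t - m.Q₄ t)

/-- The relative velocity `v₋ = v₃ - v₄`. -/
def vrel (m : Motion) (t : ℝ) : Plane := m.v₃ t - m.v₄ t

/-- The distance between the two light particles. -/
def sep (m : Motion) (t : ℝ) : ℝ := ‖m.Q₃ t - m.Q₄ t‖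

/-- The energy of the relative motion, `|v₋|² / 4 - μ / (2 |Q₋|)`. -/
def relEnergy (m : Motion) (μ t : ℝ) : ℝ := ‖m.vrel t‖ ^ 2 / 4 - μ / (2 * ‖m.Qrel t‖)

/-- The positive solution `ℒ` of `1 / (4 ℒ²) = |v₋|² / 4 - μ / (2 |Q₋|)`
(meaningful when the right-hand side is positive). -/
def Lin (m : Motion) (μ t : ℝ) : ℝ := 1 / (2 * √(m.relEnergy μ t))

/-- The angular momentum `v₋ × Q₋` of the relative motion. -/
def Gin (m : Motion) (t : ℝ) : ℝ := cross (m.vrel t) (m.Qrel t)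

/-- The scattering angle `π + 2 arctan (G / (μ ℒ))`, computed from the state at time `t`. -/
def angle (m : Motion) (μ t : ℝ) : ℝ := π + 2 * arctan (m.Gin t / (μ * m.Lin μ t))

/-- The motion is a collision-free solution of Hamilton's equations on `[a, b]`. -/
structure IsSolution (m : Motion) (μ χ a b : ℝ) : Prop where
  ne₃₁ : ∀ t ∈ Icc a b, m.Q₃ t ≠ center₁ χ
  ne₃₂ : ∀ t ∈ Icc a b, m.Q₃ t ≠ 0
  ne₄₁ : ∀ t ∈ Icc a b, m.Q₄ t ≠ center₁ χ
  ne₄₂ : ∀ t ∈ Icc a b, m.Q₄ t ≠ 0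
  ne₃₄ : ∀ t ∈ Icc a b, m.Q₃ t ≠ m.Q₄ t
  deriv_Q₃ : ∀ t ∈ Icc a b, HasDerivWithinAt m.Q₃ (m.v₃ t) (Icc a b) t
  deriv_Q₄ : ∀ t ∈ Icc a b, HasDerivWithinAt m.Q₄ (m.v₄ t) (Icc a b) t
  deriv_v₃ : ∀ t ∈ Icc a b, HasDerivWithinAt m.v₃
    (attraction (m.Q₃ t) 0 + attraction (m.Q₃ t) (center₁ χ)
      + μ • attraction (m.Q₃ t) (m.Q₄ t)) (Icc a b) t
  deriv_v₄ : ∀ t ∈ Icc a b, HasDerivWithinAt m.v₄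
    (attraction (m.Q₄ t) 0 + attraction (m.Q₄ t) (center₁ χ)
      + μ • attraction (m.Q₄ t) (m.Q₃ t)) (Icc a b) t

/-- At time `t` the total energy is zero, `Q₃` is captured by `Q₂` (its Kepler energy is negative,
bounded, and bounded away from zero), and `Q₃` is not close to `Q₂`; `K` quantifies the bounds. -/
structure IsAdmissibleAt (m : Motion) (K μ χ t : ℝ) : Prop where
  energy_zero : hamiltonian μ χ (m.Q₃ t) (m.Q₄ t) (m.v₃ t) (m.v₄ t) = 0
  kepler_energy : ‖m.v₃ t‖ ^ 2 / 2 - 1 / ‖m.Q₃ t‖ ∈ Icc (-K) (-(1 / K))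
  far_from_center : 1 / K ≤ ‖m.Q₃ t‖

/-- A piece of admissible orbit that starts at time `a` on the sphere `|Q₃ - Q₄| = μ ^ κ` and
stays in the ball bounded by it up to time `b` (it need not have left the ball by then). -/
structure IsInnerArc (m : Motion) (κ K μ χ a b : ℝ) : Prop where
  le : a ≤ b
  solution : m.IsSolution μ χ a b
  admissible : m.IsAdmissibleAt K μ χ a
  start : m.sep a = μ ^ κ
  inside : ∀ t ∈ Icc a b, m.sep t ≤ μ ^ κ

/-- A complete passage: the orbit enters the ball at time `a` and is back on the sphere, after
a positive time, at time `b`. -/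
structure IsPassage (m : Motion) (κ K μ χ a b : ℝ) : Prop extends
    IsInnerArc m κ K μ χ a b where
  lt : a < b
  finish : m.sep b = μ ^ κ

end Motion

end TwoCenterTwoBody

end

open TwoCenterTwoBody

/-!
The separation `x = Q₃ - Q₄` and the relative velocity `v = v₃ - v₄` obey a Kepler law with
perturbation: `v' = -2 μ x / |x|³ + Δ`, where `Δ` is the difference of the forces of the two fixed
centres at `Q₃` and `Q₄`, so that `|Δ| ≤ L |x|`. Everything follows from the fact that, inside the
ball `|x| ≤ ρ = μ ^ κ`, the first integrals of the Kepler problem are almost conserved.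

* The energy `E = |v|² / 4 - μ / |x|` is bounded away from `0` and `∞` at the start: zero total
  energy and the capture of `Q₃` force `|v₄| - |v₃|` to be bounded below
  (`Motion.IsAdmissibleAt.initial_bounds`). As long as this persists,
  `(x · v)' = 4 E + 2 μ / |x| + x · Δ` is bounded below, so `|x|²` is uniformly convex and the arc
  lasts a time `O(ρ)` (`PerturbedKepler.duration_le`). Near collisions `|v|` is unbounded, but
  `|x| |v| = O(ρ)`, and this is all that enters the derivatives of the first integrals. Hence, over
  an arc, `E` changes by `O(ρ²)`, the angular momentum `x × v` by `O(ρ³)`, and the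
  Laplace-Runge-Lenz vector (multiplied by `2 μ`) by `O(ρ³)`. The centre of mass does not feel the
  mutual attraction and moves by `O(ρ)`. A continuation argument (`lt_of_bootstrap`,
  `Motion.IsInnerArc.excursion_le`) removes the proviso.

* Put `u = -(x × v) √E / μ = G / (μ ℒ)`, which is constant up to `O(ρ³ / μ)`, and let `J` be the
  rotation by a right angle. At the start and the end of a passage `|x| = ρ`, and the vector
  `2 √E x / |x|` equals `-v` and `v`, respectively, up to `O((1 + |u|) μ / ρ + ρ²)`
  (`PerturbedKepler.norm_radial_sub_le`), so the conservation of the Laplace-Runge-Lenz vector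
  becomes `(u + J) v⁺ ≈ (u - J) v⁻` (`PerturbedKepler.norm_scattering_le`). As `(u - J) / (u + J)`
  is the rotation by `π + 2 arctan u`, and `|u + J| = √(1 + u²)` compensates the factor `1 + |u|` in
  the error (`norm_sub_rot_le`), the velocity is rotated by the scattering angle up to
  `O(ρ³ / μ + μ / ρ)`, uniformly in `u`. With `ρ = μ ^ κ` the two terms are `μ ^ (3 κ - 1)` and
  `μ ^ (1 - κ) ≤ μ ^ ((1 - 2 κ) / 3)`.

* An angle away from `0` and `2 π` bounds `|u|`, so `x × v = O(μ)` throughout; at the pericentre,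
  where `x · v = 0`, this bounds `|x|`, and on the sphere it makes `v` almost radial. An angle away
  from `π` bounds `|u|` from below, so `|x × v|` is at least a multiple of `μ` throughout, and
  `|x × v|² ≤ |x|² |v|² = 4 E |x|² + 4 μ |x|` keeps the particles apart.
-/

namespace TwoCenterTwoBody

/-! ### Plane geometry -/

theorem inner_plane (x y : Plane) : inner ℝ x y = x 0 * y 0 + x 1 * y 1 := by
  simp [PiLp.inner_apply, Fin.sum_univ_two, mul_comm]

theorem norm_sq_plane (x : Plane) : ‖x‖ ^ 2 = x 0 ^ 2 + x 1 ^ 2 := by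
  simp [EuclideanSpace.norm_sq_eq, Fin.sum_univ_two]

/-- The rotation of the plane by a right angle, counterclockwise. -/
noncomputable def quarterTurn : Plane →ₗᵢ[ℝ] Plane where
  toFun y := !₂[-y 1, y 0]
  map_add' x y := by ext i; fin_cases i <;> simp [add_comm]
  map_smul' c x := by ext i; fin_cases i <;> simp
  norm_map' x := by
    rw [← sq_eq_sq₀ (norm_nonneg _) (norm_nonneg _)]
    simp [norm_sq_plane, add_comm]

@[simp] theorem quarterTurn_zero_coord (x : Plane) : quarterTurn x 0 = -x 1 := rfl

@[simp] theorem quarterTurn_one_coord (x : Plane) : quarterTurn x 1 = x 0 := rfl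

theorem quarterTurn_quarterTurn (x : Plane) : quarterTurn (quarterTurn x) = -x := by
  ext i; fin_cases i <;> simp

theorem cross_eq_inner (x y : Plane) : cross x y = inner ℝ (quarterTurn x) y := by
  simp [cross, inner_plane]; ring

theorem rot_eq (α : ℝ) (x : Plane) : rot α x = cos α • x + sin α • quarterTurn x := by
  ext i; fin_cases i <;> simp [rot] <;> ring

theorem cross_sq_add_inner_sq (x y : Plane) :
    cross x y ^ 2 + inner ℝ x y ^ 2 = ‖x‖ ^ 2 * ‖y‖ ^ 2 := by
  rw [norm_sq_plane, norm_sq_plane, inner_plane, cross]; ring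

theorem abs_cross_le (x y : Plane) : |cross x y| ≤ ‖x‖ * ‖y‖ := by
  rw [cross_eq_inner, ← quarterTurn.norm_map x]
  exact abs_real_inner_le_norm _ _

theorem cross_smul_left (c : ℝ) (x y : Plane) : cross (c • x) y = c * cross x y := by
  simp [cross]; ring

theorem cross_smul_right (c : ℝ) (x y : Plane) : cross x (c • y) = c * cross x y := by
  simp [cross]; ring

theorem cross_self (x : Plane) : cross x x = 0 := by simp [cross]; ring

theorem cross_comm (x y : Plane) : cross x y = -cross y x := by simp [cross]; ring

theorem cross_add_right (x y z : Plane) : cross x (y + z) = cross x y + cross x z := by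
  simp [cross]; ring

/-- Two planar vectors of the same length whose angle is at most a right angle are as close as
their cross product allows. -/
theorem norm_smul_unit_sub_le {e v : Plane} (he : ‖e‖ = 1) (hv : 0 ≤ inner ℝ e v) :
    ‖‖v‖ • e - v‖ ≤ 2 * |cross e v| := by
  have h1 := cross_sq_add_inner_sq e v
  have h2 : ‖‖v‖ • e - v‖ ^ 2 = 2 * ‖v‖ * (‖v‖ - inner ℝ e v) := by
    rw [norm_sub_sq_real, inner_smul_left, norm_smul, he]
    simp; ring
  have h3 : inner ℝ e v ≤ ‖v‖ := by
    have := real_inner_le_norm e v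
    rwa [he, one_mul] at this
  refine abs_le_of_sq_le_sq' ?_ (by positivity) |>.2
  rw [h2, mul_pow, sq_abs]
  rw [he] at h1
  nlinarith [norm_nonneg v]

/-- An angle that is at most a right angle is bounded by its sine, hence by the cross product. -/
theorem angle_le_of_abs_cross_le {x y : Plane} {c : ℝ} (hxy : 0 ≤ inner ℝ x y)
    (hx : x ≠ 0) (hy : y ≠ 0) (hc : |cross x y| ≤ c * (‖x‖ * ‖y‖)) :
    InnerProductGeometry.angle x y ≤ 2 * c := by
  have hx' := norm_pos_iff.2 hx
  have hy' := norm_pos_iff.2 hy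
  set φ := InnerProductGeometry.angle x y with hφ
  have h0 : 0 ≤ φ := InnerProductGeometry.angle_nonneg x y
  have h1 : φ ≤ π / 2 := arccos_le_pi_div_two.2 (by positivity)
  have h2 : sin φ * (‖x‖ * ‖y‖) = |cross x y| := by
    rw [InnerProductGeometry.sin_angle_mul_norm_mul_norm, ← sqrt_sq_eq_abs]
    congr 1
    have := cross_sq_add_inner_sq x y
    rw [real_inner_self_eq_norm_sq, real_inner_self_eq_norm_sq]
    linarith
  have h3 : sin φ ≤ c := by
    rw [← h2] at hc
    exact le_of_mul_le_mul_right hc (by positivity)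
  have h4 := mul_le_sin h0 h1
  have h5 : 1 / 2 ≤ 2 / π := by
    rw [div_le_div_iff₀ two_pos pi_pos]; linarith [pi_le_four]
  nlinarith

/-- The Newtonian attraction is Lipschitz away from the attracting centre. -/
theorem norm_attraction_sub_le {p q c : Plane} {d : ℝ} (hd : 0 < d) (hp : d ≤ ‖c - p‖)
    (hq : d ≤ ‖c - q‖) :
    ‖attraction p c - attraction q c‖ ≤ 4 / d ^ 3 * ‖p - q‖ := by
  unfold attraction
  have hpq : ‖p - q‖ = ‖(c - p) - (c - q)‖ := by
    rw [sub_sub_sub_cancel_left, norm_sub_rev]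
  rw [hpq]
  generalize c - p = y at *
  generalize c - q = z at *
  have hy : 0 < ‖y‖ := hd.trans_le hp
  have hz : 0 < ‖z‖ := hd.trans_le hq
  have h1 : (‖y‖ ^ 3)⁻¹ • y - (‖z‖ ^ 3)⁻¹ • z
      = (‖y‖ ^ 3)⁻¹ • (y - z) + ((‖y‖ ^ 3)⁻¹ - (‖z‖ ^ 3)⁻¹) • z := by
    rw [smul_sub, sub_smul]; abel
  have h2 : |(‖y‖ ^ 3)⁻¹ - (‖z‖ ^ 3)⁻¹| * ‖z‖
      = |‖z‖ - ‖y‖| * (‖y‖⁻¹ ^ 3 + ‖y‖⁻¹ ^ 2 * ‖z‖⁻¹ + ‖y‖⁻¹ * ‖z‖⁻¹ ^ 2) := by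
    have : (‖y‖ ^ 3)⁻¹ - (‖z‖ ^ 3)⁻¹ = (‖z‖ - ‖y‖) *
        ((‖y‖⁻¹ ^ 3 + ‖y‖⁻¹ ^ 2 * ‖z‖⁻¹ + ‖y‖⁻¹ * ‖z‖⁻¹ ^ 2) * ‖z‖⁻¹) := by
      field_simp; ring
    rw [this, abs_mul, abs_of_nonneg (a := _ * ‖z‖⁻¹) (by positivity)]
    field_simp
  have h3 : |‖z‖ - ‖y‖| ≤ ‖y - z‖ := by
    rw [norm_sub_rev]; exact abs_norm_sub_norm_le z y
  have hy' : ‖y‖⁻¹ ≤ d⁻¹ := inv_anti₀ hd hp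
  have hz' : ‖z‖⁻¹ ≤ d⁻¹ := inv_anti₀ hd hq
  calc ‖(‖y‖ ^ 3)⁻¹ • y - (‖z‖ ^ 3)⁻¹ • z‖
      ≤ ‖y‖⁻¹ ^ 3 * ‖y - z‖ + |(‖y‖ ^ 3)⁻¹ - (‖z‖ ^ 3)⁻¹| * ‖z‖ := by
        rw [h1]
        refine (norm_add_le _ _).trans_eq ?_
        rw [norm_smul, norm_smul, norm_eq_abs, norm_eq_abs, abs_of_pos (a := (‖y‖ ^ 3)⁻¹)
          (by positivity), inv_pow]
    _ ≤ d⁻¹ ^ 3 * ‖y - z‖ + ‖y - z‖ * (d⁻¹ ^ 3 + d⁻¹ ^ 2 * d⁻¹ + d⁻¹ * d⁻¹ ^ 2) := by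
        rw [h2]; gcongr
    _ = 4 / d ^ 3 * ‖y - z‖ := by field_simp; ring

theorem norm_attraction_le {q c : Plane} {d : ℝ} (hd : 0 < d) (hq : d ≤ ‖c - q‖) :
    ‖attraction q c‖ ≤ 1 / d ^ 2 := by
  have h : 0 < ‖c - q‖ := hd.trans_le hq
  rw [attraction, norm_smul, norm_eq_abs, abs_of_pos (by positivity)]
  calc (‖c - q‖ ^ 3)⁻¹ * ‖c - q‖ = 1 / ‖c - q‖ ^ 2 := by field_simp
    _ ≤ 1 / d ^ 2 := by gcongr

/-! ### Calculus on a compact interval -/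

theorem hasDerivWithinAt_quarterTurn {f : ℝ → Plane} {f' : Plane} {s : Set ℝ} {t : ℝ}
    (hf : HasDerivWithinAt f f' s t) :
    HasDerivWithinAt (fun t => quarterTurn (f t)) (quarterTurn f') s t :=
  quarterTurn.toContinuousLinearMap.hasFDerivAt.comp_hasDerivWithinAt t hf

theorem hasDerivWithinAt_cross {f g : ℝ → Plane} {f' g' : Plane} {s : Set ℝ} {t : ℝ}
    (hf : HasDerivWithinAt f f' s t) (hg : HasDerivWithinAt g g' s t) :
    HasDerivWithinAt (fun t => cross (f t) (g t)) (cross (f t) g' + cross f' (g t)) s t := by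
  simpa only [cross_eq_inner] using (hasDerivWithinAt_quarterTurn hf).inner ℝ hg

theorem hasDerivWithinAt_inv_norm {x : ℝ → Plane} {v : Plane} {s : Set ℝ} {t : ℝ}
    (hx : HasDerivWithinAt x v s t) (h0 : x t ≠ 0) :
    HasDerivWithinAt (fun t => ‖x t‖⁻¹) (-(inner ℝ (x t) v * (‖x t‖ ^ 3)⁻¹)) s t := by
  have hp := norm_pos_iff.2 h0
  have h1 := (hx.norm_sq.sqrt (by positivity)).inv (by simpa using h0)
  have h2 : (fun t => √(‖x t‖ ^ 2))⁻¹ = fun t => ‖x t‖⁻¹ := by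
    ext t; simp [sqrt_sq (norm_nonneg _)]
  rw [h2] at h1
  refine h1.congr_deriv ?_
  rw [sqrt_sq hp.le]
  field_simp

/-- The direction `x / |x|` of a moving point turns with angular velocity `x × v / |x|²`. -/
theorem hasDerivWithinAt_quarterTurn_unit {x : ℝ → Plane} {v : Plane} {s : Set ℝ} {t : ℝ}
    (hx : HasDerivWithinAt x v s t) (h0 : x t ≠ 0) :
    HasDerivWithinAt (fun t => quarterTurn (‖x t‖⁻¹ • x t))
      (-((cross (x t) v * (‖x t‖ ^ 3)⁻¹) • x t)) s t := by
  refine (hasDerivWithinAt_quarterTurn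
    ((hasDerivWithinAt_inv_norm hx h0).smul hx)).congr_deriv ?_
  have hp := norm_pos_iff.2 h0
  have key : ‖x t‖ ^ 2 • quarterTurn v - inner ℝ (x t) v • quarterTurn (x t)
      = -(cross (x t) v • x t) := by
    rw [norm_sq_plane, inner_plane]
    ext i; fin_cases i <;> simp [cross] <;> ring
  have h3 : -((cross (x t) v * (‖x t‖ ^ 3)⁻¹) • x t)
      = (‖x t‖ ^ 3)⁻¹ • -(cross (x t) v • x t) := by
    rw [smul_neg, smul_smul, mul_comm]
  rw [h3, ← key, smul_sub, smul_smul, smul_smul, map_add, map_smul, map_smul, neg_smul,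
    ← sub_eq_add_neg]
  congr 2
  · field_simp
  · ring

theorem monotoneOn_of_hasDerivWithinAt {f f' : ℝ → ℝ} {a b : ℝ}
    (hf : ∀ t ∈ Icc a b, HasDerivWithinAt f (f' t) (Icc a b) t)
    (h : ∀ t ∈ Icc a b, 0 ≤ f' t) : MonotoneOn f (Icc a b) := by
  have hd : ∀ t ∈ interior (Icc a b), HasDerivAt f (f' t) t := fun t ht =>
    (hf t (interior_subset ht)).hasDerivAt (mem_interior_iff_mem_nhds.1 ht)
  refine monotoneOn_of_deriv_nonneg (convex_Icc a b) (fun t ht => (hf t ht).continuousWithinAt)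
    (fun t ht => (hd t ht).differentiableAt.differentiableWithinAt) fun t ht => ?_
  rw [(hd t ht).deriv]
  exact h t (interior_subset ht)

theorem norm_sub_le_of_hasDerivWithinAt {E : Type*} [NormedAddCommGroup E] [NormedSpace ℝ E]
    {f f' : ℝ → E} {a b C T : ℝ}
    (hf : ∀ t ∈ Icc a b, HasDerivWithinAt f (f' t) (Icc a b) t)
    (h : ∀ t ∈ Icc a b, ‖f' t‖ ≤ C) (hT : b - a ≤ T) {s t : ℝ} (hs : s ∈ Icc a b)
    (ht : t ∈ Icc a b) : ‖f t - f s‖ ≤ C * T := by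
  refine ((convex_Icc a b).norm_image_sub_le_of_norm_hasDerivWithin_le hf h hs ht).trans ?_
  have hC : 0 ≤ C := (norm_nonneg _).trans (h t ht)
  gcongr
  rw [norm_eq_abs, abs_le]
  constructor <;> linarith [hs.1, hs.2, ht.1, ht.2]

/-- Continuous induction: a continuous quantity that starts below `c`, and is strictly below `c`
at the end of every initial interval on which it is at most `c`, never reaches `c`. -/
theorem lt_of_bootstrap {f : ℝ → ℝ} {a b c : ℝ} (hf : ContinuousOn f (Icc a b))
    (ha : f a < c)
    (h : ∀ t ∈ Icc a b, (∀ s ∈ Icc a t, f s ≤ c) → f t < c) :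
    ∀ t ∈ Icc a b, f t < c := by
  by_contra! hne
  set S := {t ∈ Icc a b | c ≤ f t} with hS
  have hcl : IsClosed S := hf.preimage_isClosed_of_isClosed isClosed_Icc (isClosed_Ici (a := c))
  have hcpt : IsCompact S := isCompact_Icc.of_isClosed_subset hcl fun t ht => ht.1
  obtain ⟨t, ⟨htI, htc⟩, hmin⟩ := hcpt.exists_isLeast (by simpa [hS, Set.Nonempty] using hne)
  have hbelow : ∀ s ∈ Ico a t, f s < c := by
    intro s hs
    by_contra! hcs
    exact absurd (hmin ⟨⟨hs.1, hs.2.le.trans htI.2⟩, hcs⟩) (not_le.2 hs.2)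
  have hat : a < t := lt_of_le_of_ne htI.1 (by rintro rfl; linarith)
  have hle : ∀ s ∈ Icc a t, f s ≤ c := by
    have hc : ContinuousOn f (Icc a t) := hf.mono (Icc_subset_Icc_right htI.2)
    intro s hs
    rw [← closure_Ico hat.ne] at hs hc
    exact le_on_closure (fun s hs => (hbelow s hs).le) hc continuousOn_const hs
  exact absurd (h t htI hle) (not_lt.2 htc)

/-! ### The perturbed Kepler problem in a small ball -/

/-- The energy of a Kepler motion with position `x` and velocity `v`, for the relative motion of
two particles of mass `μ`. -/
noncomputable def keplerEnergy (μ : ℝ) (x v : Plane) : ℝ := ‖v‖ ^ 2 / 4 - μ / ‖x‖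

/-- The parameter `u` for which `π + 2 arctan u` is the scattering angle of the hyperbolic Kepler
motion through `(x, v)`. -/
noncomputable def scatterParam (μ : ℝ) (x v : Plane) : ℝ :=
  -(cross x v * √(keplerEnergy μ x v) / μ)

/-- A motion on `[a, b]` in the punctured ball of radius `ρ` that starts on the boundary, obeys the
Kepler law up to a force `Δ` of size at most `L |x|`, and has its Kepler energy in `[e₀, e₁]`. The
inequalities between the parameters express that the ball is small but not too small. -/
structure PerturbedKepler (μ L ρ e₀ e₁ a b : ℝ) (x v Δ : ℝ → Plane) : Prop where
  μ_pos : 0 < μ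
  μ_le : μ ≤ ρ
  L_nonneg : 0 ≤ L
  e₀_pos : 0 < e₀
  small : L * ρ ^ 2 ≤ 2 * e₀
  le : a ≤ b
  ne_zero : ∀ t ∈ Icc a b, x t ≠ 0
  inside : ∀ t ∈ Icc a b, ‖x t‖ ≤ ρ
  start : ‖x a‖ = ρ
  deriv_x : ∀ t ∈ Icc a b, HasDerivWithinAt x (v t) (Icc a b) t
  deriv_v : ∀ t ∈ Icc a b,
    HasDerivWithinAt v (-((2 * μ * (‖x t‖ ^ 3)⁻¹) • x t) + Δ t) (Icc a b) t
  perturbation : ∀ t ∈ Icc a b, ‖Δ t‖ ≤ L * ‖x t‖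
  energy : ∀ t ∈ Icc a b, keplerEnergy μ (x t) (v t) ∈ Icc e₀ e₁

namespace PerturbedKepler

variable {μ L ρ e₀ e₁ a b : ℝ} {x v Δ : ℝ → Plane} {s t : ℝ}

theorem ρ_pos (H : PerturbedKepler μ L ρ e₀ e₁ a b x v Δ) : 0 < ρ := H.μ_pos.trans_le H.μ_le

theorem e₁_pos (H : PerturbedKepler μ L ρ e₀ e₁ a b x v Δ) : 0 < e₁ :=
  have h := H.energy a (left_mem_Icc.2 H.le)
  H.e₀_pos.trans_le (h.1.trans h.2)

theorem norm_pos (H : PerturbedKepler μ L ρ e₀ e₁ a b x v Δ) (ht : t ∈ Icc a b) : 0 < ‖x t‖ :=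
  norm_pos_iff.2 (H.ne_zero t ht)

theorem speed_sq (H : PerturbedKepler μ L ρ e₀ e₁ a b x v Δ) (ht : t ∈ Icc a b) :
    ‖x t‖ * ‖v t‖ ^ 2 = 4 * keplerEnergy μ (x t) (v t) * ‖x t‖ + 4 * μ := by
  have h := H.norm_pos ht
  unfold keplerEnergy; field_simp; ring

theorem le_speed (H : PerturbedKepler μ L ρ e₀ e₁ a b x v Δ) (ht : t ∈ Icc a b) :
    2 * √e₀ ≤ ‖v t‖ := by
  have h := H.norm_pos ht
  have h1 := (H.energy t ht).1
  have h2 : 0 < μ / ‖x t‖ := div_pos H.μ_pos h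
  unfold keplerEnergy at h1
  refine abs_le_of_sq_le_sq' ?_ (norm_nonneg _) |>.2
  rw [mul_pow, sq_sqrt H.e₀_pos.le]
  linarith

/-- Although the speed is unbounded near a collision, its product with the distance is not. -/
theorem norm_mul_speed_le (H : PerturbedKepler μ L ρ e₀ e₁ a b x v Δ) (ht : t ∈ Icc a b) :
    ‖x t‖ * ‖v t‖ ≤ (e₁ + 2) * ρ := by
  have hx := H.norm_pos ht
  have hE := (H.energy t ht).2
  have hr := H.inside t ht
  have h1 : (‖x t‖ * ‖v t‖) ^ 2 = ‖x t‖ * (‖x t‖ * ‖v t‖ ^ 2) := by ring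
  have := H.e₁_pos
  have := H.ρ_pos
  refine abs_le_of_sq_le_sq' ?_ (by positivity) |>.2
  have h2 : ‖x t‖ * ‖v t‖ ^ 2 ≤ 4 * e₁ * ρ + 4 * ρ := by
    rw [H.speed_sq ht]
    gcongr
    exact H.μ_le
  rw [h1]
  calc ‖x t‖ * (‖x t‖ * ‖v t‖ ^ 2) ≤ ρ * (4 * e₁ * ρ + 4 * ρ) := by gcongr
    _ ≤ ((e₁ + 2) * ρ) ^ 2 := by nlinarith [sq_nonneg (e₁ * ρ)]

theorem hasDerivWithinAt_inner (H : PerturbedKepler μ L ρ e₀ e₁ a b x v Δ) (ht : t ∈ Icc a b) :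
    HasDerivWithinAt (fun t => inner ℝ (x t) (v t))
      (4 * keplerEnergy μ (x t) (v t) + 2 * μ / ‖x t‖ + inner ℝ (x t) (Δ t)) (Icc a b) t := by
  refine ((H.deriv_x t ht).inner ℝ (H.deriv_v t ht)).congr_deriv ?_
  have h := H.norm_pos ht
  rw [inner_add_right, inner_neg_right, inner_smul_right, real_inner_self_eq_norm_sq,
    real_inner_self_eq_norm_sq]
  unfold keplerEnergy; field_simp; ring

theorem le_deriv_inner (H : PerturbedKepler μ L ρ e₀ e₁ a b x v Δ) (ht : t ∈ Icc a b) :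
    2 * e₀ ≤ 4 * keplerEnergy μ (x t) (v t) + 2 * μ / ‖x t‖ + inner ℝ (x t) (Δ t) := by
  have h := H.norm_pos ht
  have h1 := (abs_le.1 ((abs_real_inner_le_norm (x t) (Δ t)))).1
  have h2 : ‖x t‖ * ‖Δ t‖ ≤ ρ * (L * ρ) := by
    have := H.inside t ht
    have := H.L_nonneg
    have := H.ρ_pos
    gcongr
    exact (H.perturbation t ht).trans (by gcongr)
  have h3 : 0 < 2 * μ / ‖x t‖ := div_pos (by linarith [H.μ_pos]) h
  have h4 := (H.energy t ht).1
  have h5 := H.small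
  linarith

theorem inner_growth (H : PerturbedKepler μ L ρ e₀ e₁ a b x v Δ) (hs : s ∈ Icc a b)
    (ht : t ∈ Icc a b) (hst : s ≤ t) :
    inner ℝ (x s) (v s) + 2 * e₀ * (t - s) ≤ inner ℝ (x t) (v t) := by
  have h : MonotoneOn (fun t => inner ℝ (x t) (v t) - 2 * e₀ * t) (Icc a b) :=
    monotoneOn_of_hasDerivWithinAt
      (fun t ht => (H.hasDerivWithinAt_inner ht).sub ((hasDerivWithinAt_id t _).const_mul (2 * e₀)))
      fun t ht => by linarith [H.le_deriv_inner ht]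
  have := h hs ht hst
  simp only at this
  linarith

theorem norm_sq_growth (H : PerturbedKepler μ L ρ e₀ e₁ a b x v Δ) :
    ‖x a‖ ^ 2 + 2 * inner ℝ (x a) (v a) * (b - a) + 2 * e₀ * (b - a) ^ 2 ≤ ‖x b‖ ^ 2 := by
  have ha : a ∈ Icc a b := left_mem_Icc.2 H.le
  have hb : b ∈ Icc a b := right_mem_Icc.2 H.le
  have h : MonotoneOn (fun t => ‖x t‖ ^ 2 -
      (2 * inner ℝ (x a) (v a) * (t - a) + 2 * e₀ * (t - a) ^ 2)) (Icc a b) := by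
    refine monotoneOn_of_hasDerivWithinAt
      (fun t ht => (H.deriv_x t ht).norm_sq.sub
        ((((hasDerivWithinAt_id t _).sub_const a).const_mul (2 * inner ℝ (x a) (v a))).add
          ((((hasDerivWithinAt_id t _).sub_const a).pow 2).const_mul (2 * e₀))))
      fun t ht => ?_
    have := H.inner_growth ha ht ht.1
    simp only [id, Nat.cast_ofNat, Nat.add_one_sub_one, pow_one]
    linarith
  have := h ha hb H.le
  simp only at this
  linarith

/-- Since `|x|²` is uniformly convex in time, the ball can be inhabited only for a time comparable
with its radius. -/
theorem duration_le (H : PerturbedKepler μ L ρ e₀ e₁ a b x v Δ) :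
    b - a ≤ (e₁ + 2) / e₀ * ρ := by
  have ha : a ∈ Icc a b := left_mem_Icc.2 H.le
  have hb : b ∈ Icc a b := right_mem_Icc.2 H.le
  have h1 := H.norm_sq_growth
  have h2 : ‖x b‖ ^ 2 ≤ ‖x a‖ ^ 2 := by
    have := H.inside b hb
    rw [H.start]; gcongr
  have h3 := (abs_le.1 ((abs_real_inner_le_norm (x a) (v a)).trans (H.norm_mul_speed_le ha))).1
  have he := H.e₀_pos
  have h1e := H.e₁_pos
  have hρ := H.ρ_pos
  rcases H.le.eq_or_lt with rfl | hab
  · simp; positivity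
  · have hT : 0 < b - a := sub_pos.2 hab
    rw [div_mul_eq_mul_div, le_div_iff₀ he]
    have : (b - a) * ((b - a) * e₀) ≤ (b - a) * ((e₁ + 2) * ρ) := by nlinarith
    exact le_of_mul_le_mul_left this hT

/-- A passage has a pericentre. -/
theorem exists_inner_eq_zero (H : PerturbedKepler μ L ρ e₀ e₁ a b x v Δ) (hab : a < b)
    (hb : ‖x b‖ = ρ) : ∃ t ∈ Ioo a b, inner ℝ (x t) (v t) = 0 := by
  have hd : ∀ t ∈ Icc a b, HasDerivWithinAt (fun t => ‖x t‖ ^ 2) (2 * inner ℝ (x t) (v t))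
      (Icc a b) t := fun t ht => (H.deriv_x t ht).norm_sq
  obtain ⟨t, ht, h0⟩ := exists_hasDerivAt_eq_zero hab
    (f := fun t => ‖x t‖ ^ 2) (f' := fun t => 2 * inner ℝ (x t) (v t))
    (fun t ht => (hd t ht).continuousWithinAt) (by simp only [H.start, hb])
    fun t ht => (hd t (Ioo_subset_Icc_self ht)).hasDerivAt (Icc_mem_nhds ht.1 ht.2)
  exact ⟨t, ht, by linarith⟩

/-- The particles approach each other at the start of a passage. -/
theorem inner_start_neg (H : PerturbedKepler μ L ρ e₀ e₁ a b x v Δ) (hab : a < b)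
    (hb : ‖x b‖ = ρ) : inner ℝ (x a) (v a) < 0 := by
  obtain ⟨t, ht, h0⟩ := H.exists_inner_eq_zero hab hb
  have h1 := H.inner_growth (left_mem_Icc.2 H.le) (Ioo_subset_Icc_self ht) ht.1.le
  have := mul_pos H.e₀_pos (sub_pos.2 ht.1)
  linarith

theorem inner_finish_pos (H : PerturbedKepler μ L ρ e₀ e₁ a b x v Δ) (hab : a < b)
    (hb : ‖x b‖ = ρ) : 0 < inner ℝ (x b) (v b) := by
  obtain ⟨t, ht, h0⟩ := H.exists_inner_eq_zero hab hb
  have h1 := H.inner_growth (Ioo_subset_Icc_self ht) (right_mem_Icc.2 H.le) ht.2.le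
  have := mul_pos H.e₀_pos (sub_pos.2 ht.2)
  linarith

/-! ### Approximately conserved quantities -/

theorem abs_energy_sub_le (H : PerturbedKepler μ L ρ e₀ e₁ a b x v Δ) (hs : s ∈ Icc a b)
    (ht : t ∈ Icc a b) :
    |keplerEnergy μ (x t) (v t) - keplerEnergy μ (x s) (v s)|
      ≤ L * (e₁ + 2) ^ 2 / e₀ * ρ ^ 2 := by
  have hd : ∀ t ∈ Icc a b, HasDerivWithinAt (fun t => keplerEnergy μ (x t) (v t))
      (inner ℝ (v t) (Δ t) / 2) (Icc a b) t := by
    intro t ht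
    have h := H.norm_pos ht
    refine (((H.deriv_v t ht).norm_sq.div_const 4).sub
      ((hasDerivWithinAt_inv_norm (H.deriv_x t ht) (H.ne_zero t ht)).const_mul μ)).congr_deriv ?_
    rw [inner_add_right, inner_neg_right, inner_smul_right, real_inner_comm (v t) (x t)]
    ring
  refine (norm_sub_le_of_hasDerivWithinAt (C := L * ((e₁ + 2) * ρ)) hd (fun t ht => ?_)
    H.duration_le hs ht).trans_eq (by ring)
  have h1 := abs_real_inner_le_norm (v t) (Δ t)
  have h2 : ‖v t‖ * ‖Δ t‖ ≤ L * ((e₁ + 2) * ρ) := by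
    calc ‖v t‖ * ‖Δ t‖ ≤ ‖v t‖ * (L * ‖x t‖) := by gcongr; exact H.perturbation t ht
      _ = L * (‖x t‖ * ‖v t‖) := by ring
      _ ≤ _ := mul_le_mul_of_nonneg_left (H.norm_mul_speed_le ht) H.L_nonneg
  rw [norm_eq_abs, abs_div, abs_two]
  have := abs_nonneg (inner ℝ (v t) (Δ t))
  linarith

theorem hasDerivWithinAt_cross (H : PerturbedKepler μ L ρ e₀ e₁ a b x v Δ) (ht : t ∈ Icc a b) :
    HasDerivWithinAt (fun t => cross (x t) (v t)) (cross (x t) (Δ t)) (Icc a b) t := by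
  refine (TwoCenterTwoBody.hasDerivWithinAt_cross (H.deriv_x t ht) (H.deriv_v t ht)).congr_deriv ?_
  rw [cross_add_right, cross_self, ← neg_smul, cross_smul_right, cross_self]
  ring

theorem abs_cross_perturbation_le (H : PerturbedKepler μ L ρ e₀ e₁ a b x v Δ)
    (ht : t ∈ Icc a b) : |cross (x t) (Δ t)| ≤ L * ‖x t‖ ^ 2 := by
  calc |cross (x t) (Δ t)| ≤ ‖x t‖ * ‖Δ t‖ := abs_cross_le _ _
    _ ≤ ‖x t‖ * (L * ‖x t‖) := by gcongr; exact H.perturbation t ht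
    _ = L * ‖x t‖ ^ 2 := by ring

theorem abs_cross_sub_le (H : PerturbedKepler μ L ρ e₀ e₁ a b x v Δ) (hs : s ∈ Icc a b)
    (ht : t ∈ Icc a b) :
    |cross (x t) (v t) - cross (x s) (v s)| ≤ L * (e₁ + 2) / e₀ * ρ ^ 3 := by
  refine (norm_sub_le_of_hasDerivWithinAt (C := L * ρ ^ 2) (fun t ht => H.hasDerivWithinAt_cross ht)
    (fun t ht => (H.abs_cross_perturbation_le ht).trans ?_) H.duration_le hs ht).trans_eq (by ring)
  have := H.L_nonneg
  have := H.inside t ht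
  gcongr

/-- The quarter turn of the Laplace-Runge-Lenz vector, multiplied by `2 μ`. -/
noncomputable def lrl (μ : ℝ) (x v : Plane) : Plane :=
  cross x v • v - (2 * μ) • quarterTurn (‖x‖⁻¹ • x)

/-- The Kepler part of the force cancels in the derivative of the Laplace-Runge-Lenz vector. -/
theorem norm_lrl_sub_le (H : PerturbedKepler μ L ρ e₀ e₁ a b x v Δ) (hs : s ∈ Icc a b)
    (ht : t ∈ Icc a b) :
    ‖lrl μ (x t) (v t) - lrl μ (x s) (v s)‖ ≤ 2 * L * (e₁ + 2) ^ 2 / e₀ * ρ ^ 3 := by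
  have hd : ∀ t ∈ Icc a b, HasDerivWithinAt (fun t => lrl μ (x t) (v t))
      (cross (x t) (v t) • Δ t + cross (x t) (Δ t) • v t) (Icc a b) t := by
    intro t ht
    refine (((H.hasDerivWithinAt_cross ht).smul (H.deriv_v t ht)).sub
      ((hasDerivWithinAt_quarterTurn_unit (H.deriv_x t ht) (H.ne_zero t ht)).const_smul
        (2 * μ))).congr_deriv ?_
    module
  refine (norm_sub_le_of_hasDerivWithinAt (C := 2 * (L * ρ * ((e₁ + 2) * ρ))) hd
    (fun t ht => ?_) H.duration_le hs ht).trans_eq (by ring)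
  have hL := H.L_nonneg
  have hr := H.inside t ht
  have hS := H.norm_mul_speed_le ht
  have hρ := H.ρ_pos
  have h1 : ‖cross (x t) (v t) • Δ t‖ ≤ L * ρ * ((e₁ + 2) * ρ) := by
    rw [norm_smul, norm_eq_abs, mul_comm]
    have := (abs_cross_le (x t) (v t)).trans hS
    gcongr
    exact (H.perturbation t ht).trans (by gcongr)
  have h2 : ‖cross (x t) (Δ t) • v t‖ ≤ L * ρ * ((e₁ + 2) * ρ) := by
    rw [norm_smul, norm_eq_abs]
    calc |cross (x t) (Δ t)| * ‖v t‖ ≤ L * ‖x t‖ ^ 2 * ‖v t‖ := by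
          gcongr; exact H.abs_cross_perturbation_le ht
      _ = L * ‖x t‖ * (‖x t‖ * ‖v t‖) := by ring
      _ ≤ _ := by gcongr
  exact (norm_add_le _ _).trans (by linarith)

end PerturbedKepler

/-! ### Scattering by the perturbed Kepler problem -/

/-- A pair of vectors that almost satisfies `(u + J) w = (u - J) z`, where `J` is the quarter turn,
is almost related by the rotation by `π + 2 arctan u`. -/
theorem norm_sub_rot_le (u : ℝ) (z w : Plane) :
    ‖w - rot (π + 2 * arctan u) z‖ * (1 + |u|)
      ≤ 2 * ‖u • (w - z) + quarterTurn (w + z)‖ := by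
  set D := u • (w - z) + quarterTurn (w + z) with hD
  have hu : 0 < 1 + u ^ 2 := by positivity
  have hc : cos (π + 2 * arctan u) = -(1 - u ^ 2) / (1 + u ^ 2) := by
    rw [add_comm, cos_add_pi, cos_two_mul, cos_sq_arctan]; field_simp; ring
  have hs : sin (π + 2 * arctan u) = -(2 * u) / (1 + u ^ 2) := by
    have : sin (arctan u) = u * cos (arctan u) := by rw [sin_arctan, cos_arctan]; ring
    rw [add_comm, sin_add_pi, sin_two_mul, this, mul_assoc, mul_assoc, ← sq, cos_sq_arctan]; ring
  have h1 : (1 + u ^ 2) • (w - rot (π + 2 * arctan u) z) = u • D - quarterTurn D := by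
    rw [rot_eq, hc, hs, hD]
    simp only [map_add, map_sub, map_smul, quarterTurn_quarterTurn, smul_sub, smul_add, smul_smul]
    rw [mul_div_cancel₀ _ hu.ne', mul_div_cancel₀ _ hu.ne']
    module
  have h2 : (1 + u ^ 2) * ‖w - rot (π + 2 * arctan u) z‖ ≤ (1 + |u|) * ‖D‖ := by
    have := congrArg norm h1
    rw [norm_smul, norm_eq_abs, abs_of_pos hu] at this
    rw [this]
    refine (norm_sub_le _ _).trans_eq ?_
    rw [norm_smul, quarterTurn.norm_map, norm_eq_abs]; ring
  have h3 : (1 + |u|) ^ 2 ≤ 2 * (1 + u ^ 2) := by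
    nlinarith [sq_nonneg (1 - |u|), sq_abs u]
  have h4 : 0 < 1 + |u| := by positivity
  have h5 := norm_nonneg (w - rot (π + 2 * arctan u) z)
  refine le_of_mul_le_mul_left ?_ h4
  nlinarith

namespace PerturbedKepler

variable {μ L ρ e₀ e₁ a b : ℝ} {x v Δ : ℝ → Plane} {s t : ℝ}

theorem sqrt_energy_mem (H : PerturbedKepler μ L ρ e₀ e₁ a b x v Δ) (ht : t ∈ Icc a b) :
    √(keplerEnergy μ (x t) (v t)) ∈ Icc √e₀ (e₁ + 2) := by
  have h := H.energy t ht
  have := H.e₁_pos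
  refine ⟨sqrt_le_sqrt h.1, sqrt_le_iff.2 ⟨by linarith, ?_⟩⟩
  nlinarith [h.2]

theorem abs_cross_mul_sqrt_energy (H : PerturbedKepler μ L ρ e₀ e₁ a b x v Δ) :
    |cross (x t) (v t)| * √(keplerEnergy μ (x t) (v t))
      = μ * |scatterParam μ (x t) (v t)| := by
  have := H.μ_pos
  rw [scatterParam, abs_neg, abs_div, abs_mul, abs_of_nonneg (sqrt_nonneg _), abs_of_pos this]
  field_simp

theorem abs_cross_le_scatterParam (H : PerturbedKepler μ L ρ e₀ e₁ a b x v Δ)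
    (ht : t ∈ Icc a b) :
    |cross (x t) (v t)| ≤ μ * |scatterParam μ (x t) (v t)| / √e₀ := by
  rw [le_div_iff₀ (sqrt_pos.2 H.e₀_pos), ← H.abs_cross_mul_sqrt_energy]
  exact mul_le_mul_of_nonneg_left (H.sqrt_energy_mem ht).1 (abs_nonneg _)

/-- When the particles are on the sphere, the direction of motion nearly agrees, up to the sign
`σ`, with the direction of the separation; the Kepler energy at any time `s` serves to compare the
lengths. -/
theorem norm_radial_sub_le (H : PerturbedKepler μ L ρ e₀ e₁ a b x v Δ) (hs : s ∈ Icc a b)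
    (ht : t ∈ Icc a b) (hr : ‖x t‖ = ρ) {σ : ℝ} (hσ : |σ| = 1)
    (hσv : 0 ≤ σ * inner ℝ (x t) (v t)) :
    ‖(2 * √(keplerEnergy μ (x s) (v s))) • (‖x t‖⁻¹ • x t) - σ • v t‖
      ≤ (2 * (L * (e₁ + 2) ^ 2 / e₀) / √e₀ + 2 * (L * (e₁ + 2) / e₀)) * ρ ^ 2
        + 2 / √e₀ * (μ / ρ * (1 + |scatterParam μ (x s) (v s)|)) := by
  set g := √(keplerEnergy μ (x s) (v s)) with hg
  set e := ‖x t‖⁻¹ • x t with he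
  set u := scatterParam μ (x s) (v s)
  have hx := H.norm_pos ht
  have hρ := H.ρ_pos
  have hμ := H.μ_pos
  have hq : 0 < √e₀ := sqrt_pos.2 H.e₀_pos
  have hg0 : √e₀ ≤ g := (H.sqrt_energy_mem hs).1
  have hw0 := H.le_speed ht
  have hσn : ‖σ • v t‖ = ‖v t‖ := by rw [norm_smul, norm_eq_abs, hσ, one_mul]
  have hen : ‖e‖ = 1 := by rw [he, norm_smul, norm_inv, norm_norm, inv_mul_cancel₀ hx.ne']
  -- the directions differ by the sine of an angle, which the angular momentum controls
  have h1 : ‖‖v t‖ • e - σ • v t‖ ≤ 2 * (|cross (x t) (v t)| / ρ) := by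
    have h := norm_smul_unit_sub_le (e := e) (v := σ • v t) hen (by
      rw [he, inner_smul_left, inner_smul_right]
      exact mul_nonneg (by simp) hσv)
    rw [hσn] at h
    refine h.trans_eq ?_
    rw [he, cross_smul_left, cross_smul_right, abs_mul, abs_mul, hσ, one_mul, abs_inv, abs_norm, hr]
    ring
  have h2 : |cross (x t) (v t)| ≤ μ * |u| / √e₀ + L * (e₁ + 2) / e₀ * ρ ^ 3 := by
    have := abs_sub_abs_le_abs_sub (cross (x t) (v t)) (cross (x s) (v s))
    have := H.abs_cross_sub_le hs ht
    have := H.abs_cross_le_scatterParam hs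
    linarith
  have h3 : |cross (x t) (v t)| / ρ ≤ μ / ρ * |u| / √e₀ + L * (e₁ + 2) / e₀ * ρ ^ 2 := by
    rw [div_le_iff₀ hρ]
    refine h2.trans_eq ?_
    field_simp
  -- on the sphere the kinetic energy exceeds the Kepler energy only by `μ / ρ`
  have h4 : |2 * g - ‖v t‖| ≤ (2 * (L * (e₁ + 2) ^ 2 / e₀) * ρ ^ 2 + 2 * (μ / ρ)) / √e₀ := by
    have hgsq : g ^ 2 = keplerEnergy μ (x s) (v s) :=
      sq_sqrt (H.e₀_pos.le.trans (H.energy s hs).1)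
    have hprod : (2 * g - ‖v t‖) * (2 * g + ‖v t‖)
        = 4 * (keplerEnergy μ (x s) (v s) - keplerEnergy μ (x t) (v t)) - 4 * (μ / ρ) := by
      have : keplerEnergy μ (x t) (v t) = ‖v t‖ ^ 2 / 4 - μ / ρ := by rw [keplerEnergy, hr]
      rw [this, ← hgsq]; ring
    have habs : |2 * g - ‖v t‖| * (2 * g + ‖v t‖)
        ≤ 4 * (L * (e₁ + 2) ^ 2 / e₀ * ρ ^ 2) + 4 * (μ / ρ) := by
      rw [← abs_of_nonneg (a := 2 * g + ‖v t‖) (by positivity), ← abs_mul, hprod]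
      refine (abs_sub _ _).trans ?_
      rw [abs_mul, abs_of_pos (a := (4 : ℝ)) (by norm_num), abs_of_pos (a := 4 * (μ / ρ))
        (by positivity)]
      have := H.abs_energy_sub_le ht hs
      linarith
    rw [le_div_iff₀ hq]
    have : |2 * g - ‖v t‖| * (2 * √e₀) ≤ |2 * g - ‖v t‖| * (2 * g + ‖v t‖) := by
      gcongr
      linarith
    linarith
  calc ‖(2 * g) • e - σ • v t‖
      = ‖(2 * g - ‖v t‖) • e + (‖v t‖ • e - σ • v t)‖ := by congr 1; module
    _ ≤ |2 * g - ‖v t‖| + 2 * (|cross (x t) (v t)| / ρ) := by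
        refine (norm_add_le _ _).trans (add_le_add ?_ h1)
        rw [norm_smul, hen, mul_one, norm_eq_abs]
    _ ≤ (2 * (L * (e₁ + 2) ^ 2 / e₀) * ρ ^ 2 + 2 * (μ / ρ)) / √e₀
        + 2 * (μ / ρ * |u| / √e₀ + L * (e₁ + 2) / e₀ * ρ ^ 2) := by gcongr
    _ = _ := by ring

/-- Conservation of the Laplace-Runge-Lenz vector, read off on the sphere at the two ends of a
passage. -/
theorem norm_scattering_le (H : PerturbedKepler μ L ρ e₀ e₁ a b x v Δ) (hab : a < b)
    (hb : ‖x b‖ = ρ) (hs : s ∈ Icc a b) :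
    ‖scatterParam μ (x s) (v s) • (v b - v a) + quarterTurn (v b + v a)‖
      ≤ 4 * L * (e₁ + 2) ^ 3 / e₀ * (ρ ^ 3 / μ)
        + 2 * ((2 * (L * (e₁ + 2) ^ 2 / e₀) / √e₀ + 2 * (L * (e₁ + 2) / e₀)) * ρ ^ 2
        + 2 / √e₀ * (μ / ρ * (1 + |scatterParam μ (x s) (v s)|))) := by
  have haI : a ∈ Icc a b := left_mem_Icc.2 H.le
  have hbI : b ∈ Icc a b := right_mem_Icc.2 H.le
  have hμ := H.μ_pos
  have hρ := H.ρ_pos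
  have hra := H.norm_radial_sub_le hs haI H.start (σ := -1) (by simp)
    (by linarith [H.inner_start_neg hab hb])
  have hrb := H.norm_radial_sub_le hs hbI hb (σ := 1) (by simp)
    (by linarith [H.inner_finish_pos hab hb])
  have hg1 := (H.sqrt_energy_mem hs).2
  set R := (2 * (L * (e₁ + 2) ^ 2 / e₀) / √e₀ + 2 * (L * (e₁ + 2) / e₀)) * ρ ^ 2
        + 2 / √e₀ * (μ / ρ * (1 + |scatterParam μ (x s) (v s)|))
  have hu : scatterParam μ (x s) (v s)
    = -(cross (x s) (v s) * √(keplerEnergy μ (x s) (v s)) / μ) := rfl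
  set u := scatterParam μ (x s) (v s)
  set g := √(keplerEnergy μ (x s) (v s)) with hg
  have hg0 : 0 ≤ g := sqrt_nonneg _
  have he0 := H.e₀_pos
  have he1 := H.e₁_pos
  have hL := H.L_nonneg
  have hlrl : ‖(-(g / μ)) • (lrl μ (x b) (v b) - lrl μ (x a) (v a))‖
      ≤ 2 * L * (e₁ + 2) ^ 3 / e₀ * (ρ ^ 3 / μ) := by
    rw [norm_smul, norm_neg, norm_eq_abs, abs_of_nonneg (div_nonneg hg0 hμ.le)]
    calc g / μ * ‖lrl μ (x b) (v b) - lrl μ (x a) (v a)‖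
        ≤ (e₁ + 2) / μ * (2 * L * (e₁ + 2) ^ 2 / e₀ * ρ ^ 3) := by
          gcongr
          exact H.norm_lrl_sub_le haI hbI
      _ = _ := by ring
  have hcross : ∀ t ∈ Icc a b, ‖x t‖ = ρ →
      ‖(u + g * cross (x t) (v t) / μ) • v t‖ ≤ L * (e₁ + 2) ^ 3 / e₀ * (ρ ^ 3 / μ) := by
    intro t ht hr
    have hv : ‖v t‖ ≤ e₁ + 2 := by
      have := H.norm_mul_speed_le ht
      rw [hr, mul_comm] at this
      exact le_of_mul_le_mul_right this hρ
    have h1 : u + g * cross (x t) (v t) / μ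
        = g / μ * (cross (x t) (v t) - cross (x s) (v s)) := by rw [hu]; ring
    rw [h1, norm_smul, norm_eq_abs, abs_mul, abs_of_nonneg (div_nonneg hg0 hμ.le)]
    calc g / μ * |cross (x t) (v t) - cross (x s) (v s)| * ‖v t‖
        ≤ (e₁ + 2) / μ * (L * (e₁ + 2) / e₀ * ρ ^ 3) * (e₁ + 2) := by
          gcongr
          exact H.abs_cross_sub_le hs ht
      _ = _ := by ring
  have hkey : u • (v b - v a) + quarterTurn (v b + v a)
      = (-(g / μ)) • (lrl μ (x b) (v b) - lrl μ (x a) (v a))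
        + (u + g * cross (x b) (v b) / μ) • v b - (u + g * cross (x a) (v a) / μ) • v a
        - quarterTurn ((2 * g) • (‖x b‖⁻¹ • x b) - (1 : ℝ) • v b)
        + quarterTurn ((2 * g) • (‖x a‖⁻¹ • x a) - (-1 : ℝ) • v a) := by
    have h2 : 2 * g = g / μ * (2 * μ) := by field_simp
    rw [h2]
    simp only [lrl, map_add, map_sub, map_smul]
    module
  rw [hkey]
  refine (norm_add_le _ _).trans ?_
  have hra' := (quarterTurn.norm_map _).trans_le hra
  have hrb' := (quarterTurn.norm_map _).trans_le hrb
  refine (add_le_add ((norm_sub_le _ _).trans (add_le_add ((norm_sub_le _ _).trans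
    (add_le_add ((norm_add_le _ _).trans (add_le_add hlrl (hcross b hbI hb)))
      (hcross a haI H.start))) hrb')) hra').trans_eq ?_
  ring

/-- A passage through the ball rotates the velocity by the scattering angle, evaluated at any time
of the passage. -/
theorem exists_norm_sub_rot_le (L : ℝ) {e₀ : ℝ} (e₁ : ℝ) :
    ∃ C > 0, ∀ {μ ρ a b : ℝ} {x v Δ : ℝ → Plane}, PerturbedKepler μ L ρ e₀ e₁ a b x v Δ →
      a < b → ‖x b‖ = ρ → ∀ s ∈ Icc a b,
        ‖v b - rot (π + 2 * arctan (scatterParam μ (x s) (v s))) (v a)‖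
          ≤ C * (ρ ^ 3 / μ + μ / ρ) := by
  set A := 4 * L * (e₁ + 2) ^ 3 / e₀
  set B := 2 * (L * (e₁ + 2) ^ 2 / e₀) / √e₀ + 2 * (L * (e₁ + 2) / e₀)
  set D := 2 / √e₀
  refine ⟨2 * (|A| + 2 * |B| + 2 * |D|) + 1, by positivity, ?_⟩
  intro μ ρ a b x v Δ H hab hb s hs
  have hμ := H.μ_pos
  have hρ := H.ρ_pos
  have h1 := H.norm_scattering_le hab hb hs
  have h2 := norm_sub_rot_le (scatterParam μ (x s) (v s)) (v a) (v b)
  set u := scatterParam μ (x s) (v s)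
  have h3 : ρ ^ 2 ≤ ρ ^ 3 / μ := by
    rw [le_div_iff₀ hμ, pow_succ ρ 2]
    gcongr
    exact H.μ_le
  have hu : 1 ≤ 1 + |u| := by linarith [abs_nonneg u]
  have hA : A * (ρ ^ 3 / μ) ≤ |A| * (ρ ^ 3 / μ) * (1 + |u|) := by
    refine (mul_le_mul_of_nonneg_right (le_abs_self A) (by positivity)).trans ?_
    exact le_mul_of_one_le_right (by positivity) hu
  have hB : B * ρ ^ 2 ≤ |B| * (ρ ^ 3 / μ) * (1 + |u|) := by
    refine (mul_le_mul (le_abs_self B) h3 (by positivity) (abs_nonneg _)).trans ?_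
    exact le_mul_of_one_le_right (by positivity) hu
  have hD : D * (μ / ρ * (1 + |u|)) ≤ |D| * (μ / ρ) * (1 + |u|) := by
    rw [mul_assoc |D|]
    exact mul_le_mul_of_nonneg_right (le_abs_self D) (by positivity)
  have h4 : 0 ≤ |A| * (μ / ρ) * (1 + |u|) := by positivity
  have h5 : 0 ≤ |B| * (μ / ρ) * (1 + |u|) := by positivity
  have h6 : 0 ≤ |D| * (ρ ^ 3 / μ) * (1 + |u|) := by positivity
  have h7 : 0 ≤ (ρ ^ 3 / μ + μ / ρ) * (1 + |u|) := by positivity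
  refine le_of_mul_le_mul_right ?_ (zero_lt_one.trans_le hu)
  linarith

/-! ### Angular momentum and closest approach -/

theorem abs_cross_le_of_scatterParam_le (H : PerturbedKepler μ L ρ e₀ e₁ a b x v Δ)
    (hρ : ρ ^ 3 ≤ μ) {M : ℝ} (hs : s ∈ Icc a b) (hM : |scatterParam μ (x s) (v s)| ≤ M)
    (ht : t ∈ Icc a b) :
    |cross (x t) (v t)| ≤ (M / √e₀ + L * (e₁ + 2) / e₀) * μ := by
  have h1 := abs_sub_abs_le_abs_sub (cross (x t) (v t)) (cross (x s) (v s))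
  have h2 := H.abs_cross_sub_le hs ht
  have h3 := H.abs_cross_le_scatterParam hs
  have hμ := H.μ_pos
  have he0 := H.e₀_pos
  have he1 := H.e₁_pos
  have hL := H.L_nonneg
  have h4 : μ * |scatterParam μ (x s) (v s)| / √e₀ ≤ μ * M / √e₀ := by gcongr
  have h5 : L * (e₁ + 2) / e₀ * ρ ^ 3 ≤ L * (e₁ + 2) / e₀ * μ := by gcongr
  calc |cross (x t) (v t)| ≤ μ * M / √e₀ + L * (e₁ + 2) / e₀ * μ := by linarith
    _ = _ := by ring

theorem exists_norm_le_of_abs_cross_le (H : PerturbedKepler μ L ρ e₀ e₁ a b x v Δ) (hab : a < b)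
    (hb : ‖x b‖ = ρ) {c : ℝ} (hc : ∀ t ∈ Icc a b, |cross (x t) (v t)| ≤ c) :
    ∃ t ∈ Icc a b, ‖x t‖ ≤ c / (2 * √e₀) := by
  obtain ⟨t, ht, h0⟩ := H.exists_inner_eq_zero hab hb
  have ht := Ioo_subset_Icc_self ht
  refine ⟨t, ht, ?_⟩
  have hq : 0 < √e₀ := sqrt_pos.2 H.e₀_pos
  -- at the pericentre the velocity is orthogonal to the separation
  have h1 : |cross (x t) (v t)| = ‖x t‖ * ‖v t‖ := by
    have := cross_sq_add_inner_sq (x t) (v t)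
    rw [h0, ← mul_pow] at this
    rw [← abs_of_nonneg (a := ‖x t‖ * ‖v t‖) (by positivity)]
    exact (sq_eq_sq_iff_abs_eq_abs _ _).1 (by linarith)
  rw [le_div_iff₀ (by positivity)]
  calc ‖x t‖ * (2 * √e₀) ≤ ‖x t‖ * ‖v t‖ := by gcongr; exact H.le_speed ht
    _ ≤ c := h1 ▸ hc t ht

/-- On the sphere, a small angular momentum forces the velocity to be radial. -/
theorem angle_le_of_abs_cross_le (H : PerturbedKepler μ L ρ e₀ e₁ a b x v Δ) (ht : t ∈ Icc a b)
    (hr : ‖x t‖ = ρ) {c σ : ℝ} (hc : |cross (x t) (v t)| ≤ c) (hσ : |σ| = 1)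
    (hσv : 0 ≤ σ * inner ℝ (x t) (v t)) :
    InnerProductGeometry.angle (σ • x t) (v t) ≤ c / (√e₀ * ρ) := by
  have hq : 0 < √e₀ := sqrt_pos.2 H.e₀_pos
  have hρ := H.ρ_pos
  have hv := H.le_speed ht
  have hc0 : 0 ≤ c := (abs_nonneg _).trans hc
  have hσ0 : σ ≠ 0 := by rintro rfl; simp at hσ
  refine (TwoCenterTwoBody.angle_le_of_abs_cross_le (c := c / (2 * √e₀ * ρ)) ?_
    (smul_ne_zero hσ0 (H.ne_zero t ht)) (norm_pos_iff.1 (by linarith)) ?_).trans_eq ?_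
  · rwa [inner_smul_left]
  · rw [cross_smul_left, abs_mul, norm_smul, norm_eq_abs, hσ, one_mul, one_mul, hr,
      div_mul_eq_mul_div, le_div_iff₀ (by positivity)]
    calc |cross (x t) (v t)| * (2 * √e₀ * ρ) ≤ c * (‖v t‖ * ρ) := by gcongr
      _ = c * (ρ * ‖v t‖) := by ring
  · field_simp

/-- A scattering parameter that is not small bounds the angular momentum from below, which keeps the
particles apart because `|x × v|² ≤ |x| (4 E |x| + 4 μ)`. -/
theorem le_norm_of_le_scatterParam (H : PerturbedKepler μ L ρ e₀ e₁ a b x v Δ)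
    {M δ : ℝ} (hρ : L * (e₁ + 2) / e₀ * (ρ ^ 3 / μ) ≤ M / (2 * (e₁ + 2)))
    (hM : 0 < M) (hδ1 : δ ≤ 1) (hδ : 4 * (e₁ + 1) * δ ≤ (M / (2 * (e₁ + 2))) ^ 2)
    (hs : s ∈ Icc a b) (hMu : M ≤ |scatterParam μ (x s) (v s)|) (ht : t ∈ Icc a b) :
    δ * μ ≤ ‖x t‖ := by
  have hμ := H.μ_pos
  have he1 := H.e₁_pos
  have h1 := abs_sub_abs_le_abs_sub (cross (x s) (v s)) (cross (x t) (v t))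
  have h2 := H.abs_cross_sub_le ht hs
  have h3 : μ * M ≤ |cross (x s) (v s)| * (e₁ + 2) := by
    calc μ * M ≤ μ * |scatterParam μ (x s) (v s)| := by gcongr
      _ = |cross (x s) (v s)| * √(keplerEnergy μ (x s) (v s)) := H.abs_cross_mul_sqrt_energy.symm
      _ ≤ _ := by gcongr; exact (H.sqrt_energy_mem hs).2
  set c := M / (2 * (e₁ + 2)) with hcdef
  have hc : 0 < c := by positivity
  have h4 : 2 * c * μ ≤ |cross (x s) (v s)| := by
    have : 2 * c * μ * (e₁ + 2) = μ * M := by rw [hcdef]; field_simp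
    exact le_of_mul_le_mul_right (this.trans_le h3) (by linarith)
  have h5 : L * (e₁ + 2) / e₀ * ρ ^ 3 ≤ c * μ := by
    calc L * (e₁ + 2) / e₀ * ρ ^ 3 = L * (e₁ + 2) / e₀ * (ρ ^ 3 / μ) * μ := by field_simp
      _ ≤ c * μ := by gcongr
  have h6 : c * μ ≤ ‖x t‖ * ‖v t‖ := (by linarith : c * μ ≤ |_|).trans (abs_cross_le _ _)
  have hx := H.norm_pos ht
  have h7 : (c * μ) ^ 2 ≤ ‖x t‖ * (4 * e₁ * ‖x t‖ + 4 * μ) := by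
    calc (c * μ) ^ 2 ≤ (‖x t‖ * ‖v t‖) ^ 2 := by gcongr
      _ = ‖x t‖ * (‖x t‖ * ‖v t‖ ^ 2) := by ring
      _ ≤ _ := by rw [H.speed_sq ht]; gcongr; exact (H.energy t ht).2
  by_contra! hlt
  have hδ0 : 0 < δ := by
    by_contra! h
    nlinarith
  have h8 : ‖x t‖ * (4 * e₁ * ‖x t‖ + 4 * μ) < δ * μ * (4 * e₁ * μ + 4 * μ) := by
    have : ‖x t‖ ≤ μ := hlt.le.trans (by nlinarith)
    calc ‖x t‖ * (4 * e₁ * ‖x t‖ + 4 * μ) ≤ ‖x t‖ * (4 * e₁ * μ + 4 * μ) := by gcongr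
      _ < _ := by gcongr
  have h9 : δ * μ * (4 * e₁ * μ + 4 * μ) = 4 * (e₁ + 1) * δ * μ ^ 2 := by ring
  have h10 : 4 * (e₁ + 1) * δ * μ ^ 2 ≤ c ^ 2 * μ ^ 2 := by gcongr
  linarith [mul_pow c μ 2]

end PerturbedKepler

/-! ### Inner arcs as perturbed Kepler motions -/

/-- The force exerted by the two fixed centres. -/
noncomputable def centerField (χ : ℝ) (q : Plane) : Plane :=
  attraction q 0 + attraction q (center₁ χ)

/-- A lower bound for the relative energy along inner arcs; half the bound available at the
start. -/
noncomputable def energyMin (K : ℝ) : ℝ := 1 / (64 * K ^ 4)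

/-- An upper bound for the relative energy along inner arcs. -/
noncomputable def energyMax (K : ℝ) : ℝ := 8 * K

/-- A Lipschitz constant of the force of the fixed centres where encounters take place. -/
noncomputable def fieldLip (K : ℝ) : ℝ := 32 * K ^ 3 + 4

/-- A bound for the duration of an inner arc, in units of the radius of the ball. -/
noncomputable def timeConst (K : ℝ) : ℝ := (energyMax K + 2) / energyMin K

/-- The smallness of `μ`, and of the radius `ρ` of the ball, on which the estimates rely. -/
structure IsSmall (K μ ρ : ℝ) : Prop where
  μ_pos : 0 < μ
  ρ_pos : 0 < ρ
  ρ_le_one : ρ ≤ 1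
  ratio_le_one : μ / ρ ≤ 1
  ratio_le : μ / ρ ≤ energyMin K
  radius : 8 * K * ρ < 1
  radius_cube : 4 * K ^ 3 * ρ < 1
  lip : fieldLip K * ρ < 2 * energyMin K
  time : timeConst K * ρ < 1
  drift : 16 * K ^ 2 * timeConst K * (4 * K) * ρ < 1
  energy : fieldLip K * (energyMax K + 2) ^ 2 / energyMin K * ρ < energyMin K

theorem energyMin_pos {K : ℝ} (hK : 0 < K) : 0 < energyMin K := by unfold energyMin; positivity

theorem energyMax_pos {K : ℝ} (hK : 0 < K) : 0 < energyMax K := by unfold energyMax; positivity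

theorem fieldLip_pos {K : ℝ} (hK : 0 < K) : 0 < fieldLip K := by unfold fieldLip; positivity

theorem timeConst_pos {K : ℝ} (hK : 0 < K) : 0 < timeConst K := by
  have := energyMin_pos hK
  have := energyMax_pos hK
  unfold timeConst; positivity

theorem exists_isSmall {K : ℝ} (hK : 0 < K) :
    ∃ η > 0, ∀ μ ρ : ℝ, 0 < μ → 0 < ρ → ρ ≤ η → μ / ρ ≤ η → IsSmall K μ ρ := by
  have key : ∀ A B : ℝ, 0 < B → ∀ᶠ η in nhdsWithin (0 : ℝ) (Ioi 0), A * η < B := by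
    intro A B hB
    have : Filter.Tendsto (fun η : ℝ => A * η) (nhdsWithin 0 (Ioi 0)) (nhds (A * 0)) :=
      ((continuous_const_mul A).tendsto 0).mono_left nhdsWithin_le_nhds
    exact this.eventually_lt_const (by simpa using hB)
  have he := energyMin_pos hK
  have hE := energyMax_pos hK
  have hL := fieldLip_pos hK
  have hT := timeConst_pos hK
  have hpos : ∀ᶠ η in nhdsWithin (0 : ℝ) (Ioi 0), 0 < η := self_mem_nhdsWithin
  obtain ⟨η, hη, h1, h2, h3, h4, h5, h6, h7, h8⟩ := (hpos.and
    ((key 1 1 one_pos).and ((key 1 _ he).and ((key (8 * K) 1 one_pos).and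
    ((key (4 * K ^ 3) 1 one_pos).and ((key (fieldLip K) (2 * energyMin K) (by positivity)).and
    ((key (timeConst K) 1 one_pos).and ((key (16 * K ^ 2 * timeConst K * (4 * K)) 1 one_pos).and
    (key (fieldLip K * (energyMax K + 2) ^ 2 / energyMin K) _ he))))))))).exists
  rw [one_mul] at h1 h2
  refine ⟨η, hη, fun μ ρ hμ hρ hρη hr => ⟨hμ, hρ, by linarith, by linarith, by linarith, ?_, ?_,
    ?_, ?_, ?_, ?_⟩⟩
  · exact lt_of_le_of_lt (by gcongr) h3
  · exact lt_of_le_of_lt (by gcongr) h4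
  · exact lt_of_le_of_lt (by gcongr) h5
  · exact lt_of_le_of_lt (by gcongr) h6
  · exact lt_of_le_of_lt (by gcongr) h7
  · exact lt_of_le_of_lt (by gcongr) h8

theorem norm_center₁ (χ : ℝ) : ‖center₁ χ‖ = |χ| := by
  rw [← sqrt_sq (norm_nonneg _), norm_sq_plane, ← sqrt_sq_eq_abs]
  simp [center₁]

theorem one_le_norm_center₁_sub {K χ : ℝ} (hχ : K + 2 ≤ χ) {q : Plane} (hq : ‖q‖ ≤ K + 1) :
    1 ≤ ‖center₁ χ - q‖ := by
  have h1 := norm_sub_norm_le (center₁ χ) q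
  have h2 := le_abs_self χ
  rw [norm_center₁] at h1
  linarith

theorem norm_centerField_sub_le {K χ : ℝ} (hK : 0 < K) (hχ : K + 2 ≤ χ) {p q : Plane}
    (hp : 1 / (2 * K) ≤ ‖p‖) (hp' : ‖p‖ ≤ K + 1) (hq : 1 / (2 * K) ≤ ‖q‖) (hq' : ‖q‖ ≤ K + 1) :
    ‖centerField χ p - centerField χ q‖ ≤ fieldLip K * ‖p - q‖ := by
  have h1 := norm_attraction_sub_le (p := p) (q := q) (c := 0) (d := 1 / (2 * K)) (by positivity)
    (by simpa using hp) (by simpa using hq)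
  have h2 := norm_attraction_sub_le (p := p) (q := q) one_pos (one_le_norm_center₁_sub hχ hp')
    (one_le_norm_center₁_sub hχ hq')
  have h3 : 4 / (1 / (2 * K)) ^ 3 = 32 * K ^ 3 := by field_simp; norm_num
  rw [h3] at h1
  calc ‖centerField χ p - centerField χ q‖
      = ‖(attraction p 0 - attraction q 0)
          + (attraction p (center₁ χ) - attraction q (center₁ χ))‖ := by
        congr 1; simp only [centerField]; abel
    _ ≤ _ := norm_add_le _ _
    _ ≤ 32 * K ^ 3 * ‖p - q‖ + 4 / 1 ^ 3 * ‖p - q‖ := add_le_add h1 h2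
    _ = fieldLip K * ‖p - q‖ := by rw [fieldLip]; ring

theorem norm_centerField_le {K χ : ℝ} (hK : 1 ≤ K) (hχ : K + 2 ≤ χ) {q : Plane}
    (hq : 1 / (2 * K) ≤ ‖q‖) (hq' : ‖q‖ ≤ K + 1) : ‖centerField χ q‖ ≤ 5 * K ^ 2 := by
  have h1 := norm_attraction_le (q := q) (c := 0) (d := 1 / (2 * K)) (by positivity)
    (by simpa using hq)
  have h2 := norm_attraction_le one_pos (one_le_norm_center₁_sub hχ hq')
  have h3 : 1 / (1 / (2 * K)) ^ 2 = 4 * K ^ 2 := by field_simp; norm_num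
  rw [h3] at h1
  refine (norm_add_le _ _).trans ?_
  nlinarith

theorem attraction_comm (p q : Plane) : attraction p q = -attraction q p := by
  rw [attraction, attraction, norm_sub_rev, ← smul_neg, neg_sub]

namespace Motion

variable {m : Motion} {κ K μ χ a b s t : ℝ}

/-- The separation vector `Q₃ - Q₄`. -/
def diff (m : Motion) (t : ℝ) : Plane := m.Q₃ t - m.Q₄ t

theorem Qrel_eq (m : Motion) (t : ℝ) : m.Qrel t = (1 / 2 : ℝ) • m.diff t := rfl

theorem relEnergy_eq (m : Motion) (μ t : ℝ) :
    m.relEnergy μ t = keplerEnergy μ (m.diff t) (m.vrel t) := by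
  rw [relEnergy, keplerEnergy, Qrel_eq, norm_smul, norm_eq_abs, abs_of_pos one_half_pos]
  congr 2
  ring

theorem Gin_eq (m : Motion) (t : ℝ) : m.Gin t = -(1 / 2) * cross (m.diff t) (m.vrel t) := by
  rw [Gin, Qrel_eq, cross_smul_right, cross_comm]; ring

theorem angle_eq (m : Motion) (μ t : ℝ) :
    m.angle μ t = π + 2 * arctan (scatterParam μ (m.diff t) (m.vrel t)) := by
  rw [angle, Gin_eq, Lin, relEnergy_eq, scatterParam]
  congr 3
  rw [mul_one_div, div_div_eq_mul_div]
  ring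

theorem IsAdmissibleAt.norm_le (h : m.IsAdmissibleAt K μ χ t) (hK : 0 < K) : ‖m.Q₃ t‖ ≤ K := by
  have h1 := h.kepler_energy.2
  have hQ : 0 < ‖m.Q₃ t‖ := lt_of_lt_of_le (by positivity) h.far_from_center
  have h2 : 1 / K ≤ 1 / ‖m.Q₃ t‖ := by
    have := sq_nonneg ‖m.v₃ t‖
    linarith
  exact (one_div_le_one_div hK hQ).1 h2

theorem IsAdmissibleAt.one_le (h : m.IsAdmissibleAt K μ χ t) (hK : 0 < K) : 1 ≤ K := by
  have h1 := h.far_from_center.trans (h.norm_le hK)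
  rw [div_le_iff₀ hK] at h1
  nlinarith

/-- Zero total energy and the capture of `Q₃` make the second particle faster than the first by a
definite amount. -/
theorem IsAdmissibleAt.speed_bounds {ρ : ℝ} (h : m.IsAdmissibleAt K μ χ t) (hK : 0 < K)
    (hsm : IsSmall K μ ρ) (hχ : K + 2 ≤ χ) (hsep : m.sep t = ρ) :
    1 / K * 3 ≤ ‖m.v₄ t‖ ^ 2 - ‖m.v₃ t‖ ^ 2 ∧ ‖m.v₃ t‖ ^ 2 + ‖m.v₄ t‖ ^ 2 ≤ 14 * K := by
  have hK1 := h.one_le hK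
  have hQ3 := h.norm_le hK
  have hQ3' := h.far_from_center
  have hρ := hsm.ρ_pos
  have hμ := hsm.μ_pos
  have hratio1 := hsm.ratio_le_one
  have hsep' : ‖m.Q₃ t - m.Q₄ t‖ = ρ := hsep
  have hρK : ρ ≤ 1 / (2 * K) := by
    rw [le_div_iff₀ (by positivity)]; nlinarith only [hsm.radius, hK1, hρ]
  have hρ1 := hsm.ρ_le_one
  have hQ34 := abs_le.1 (hsep' ▸ abs_norm_sub_norm_le _ _ : |‖m.Q₃ t‖ - ‖m.Q₄ t‖| ≤ ρ)
  have hKhalf : 1 / K = 2 * (1 / (2 * K)) := by field_simp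
  have hQ4 : 1 / (2 * K) ≤ ‖m.Q₄ t‖ := by linarith only [hQ34.2, hQ3', hρK, hKhalf]
  have hQ3pos : 0 < ‖m.Q₃ t‖ := lt_of_lt_of_le (by positivity) hQ3'
  have hQ4pos : 0 < ‖m.Q₄ t‖ := lt_of_lt_of_le (by positivity) hQ4
  have hcenter : ∀ q : Plane, ‖q‖ ≤ K + 1 → 1 / ‖q - center₁ χ‖ ∈ Icc 0 1 := by
    intro q hq
    have h1 : 1 ≤ ‖q - center₁ χ‖ := by
      rw [norm_sub_rev]; exact one_le_norm_center₁_sub hχ hq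
    exact ⟨by positivity, by rw [div_le_one (by linarith)]; exact h1⟩
  have hi3 := hcenter (m.Q₃ t) (by linarith only [hQ3])
  have hi4 := hcenter (m.Q₄ t) (by linarith only [hQ34.1, hQ3, hρ1])
  have hinv3 : 1 / ‖m.Q₃ t‖ ≤ K := by
    rw [div_le_iff₀ hQ3pos]; rw [div_le_iff₀ hK] at hQ3'; linarith only [hQ3']
  have hinv4 : 1 / ‖m.Q₄ t‖ ≤ 2 * K := by
    rw [div_le_iff₀ hQ4pos]; rw [div_le_iff₀ (by positivity)] at hQ4; linarith only [hQ4]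
  have hinv : 1 / ‖m.Q₃ t‖ - 1 / ‖m.Q₄ t‖ ≤ 1 / (2 * K) := by
    have h1 : 1 / ‖m.Q₃ t‖ - 1 / ‖m.Q₄ t‖
        = (‖m.Q₄ t‖ - ‖m.Q₃ t‖) * ((1 / ‖m.Q₃ t‖) * (1 / ‖m.Q₄ t‖)) := by field_simp
    calc 1 / ‖m.Q₃ t‖ - 1 / ‖m.Q₄ t‖ ≤ ρ * (K * (2 * K)) := by
          rw [h1]
          have : ‖m.Q₄ t‖ - ‖m.Q₃ t‖ ≤ ρ := by linarith only [hQ34.1]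
          gcongr
      _ ≤ 1 / (2 * K) := by
          rw [le_div_iff₀ (by positivity)]
          linarith only [hsm.radius_cube]
  have hH := h.energy_zero
  rw [hamiltonian, hsep'] at hH
  obtain ⟨he1, he2⟩ := h.kepler_energy
  have hmr : 0 < μ / ρ := by positivity
  have hKpos : 0 < 1 / K := by positivity
  constructor
  · linarith only [hi3.1, hi4.1, hH, he2, hinv, hKhalf, hmr]
  · linarith only [hi3.2, hi4.2, hH, he1, he2, hinv3, hinv4, hratio1, hK1, hKpos]

/-- The relative energy is bounded, and bounded away from zero, when the encounter begins. -/
theorem IsAdmissibleAt.initial_bounds {ρ : ℝ} (h : m.IsAdmissibleAt K μ χ t) (hK : 0 < K)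
    (hsm : IsSmall K μ ρ) (hχ : K + 2 ≤ χ) (hsep : m.sep t = ρ) :
    2 * energyMin K ≤ m.relEnergy μ t ∧ m.relEnergy μ t ≤ energyMax K - energyMin K ∧
      ‖m.v₃ t + m.v₄ t‖ ≤ 6 * K := by
  have hK1 := h.one_le hK
  have hμ := hsm.μ_pos
  have hρ := hsm.ρ_pos
  have hmr : 0 < μ / ρ := by positivity
  obtain ⟨hdiff, hsq⟩ := h.speed_bounds hK hsm hχ hsep
  have hsumsq : (‖m.v₃ t‖ + ‖m.v₄ t‖) ^ 2 ≤ 28 * K := by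
    nlinarith only [sq_nonneg (‖m.v₃ t‖ - ‖m.v₄ t‖), hsq]
  have hsum : ‖m.v₃ t‖ + ‖m.v₄ t‖ ≤ 6 * K := by
    refine abs_le_of_sq_le_sq' ?_ (by positivity) |>.2
    nlinarith only [hsumsq, hK1]
  have hv : 1 / (2 * K ^ 2) ≤ ‖m.vrel t‖ := by
    have h1 : ‖m.v₄ t‖ - ‖m.v₃ t‖ ≤ ‖m.vrel t‖ := by
      rw [vrel, norm_sub_rev]; exact norm_sub_norm_le _ _
    have h2 : 1 / K * 3 ≤ ‖m.vrel t‖ * (6 * K) := by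
      calc 1 / K * 3 ≤ (‖m.v₄ t‖ - ‖m.v₃ t‖) * (‖m.v₃ t‖ + ‖m.v₄ t‖) := by linarith only [hdiff]
        _ ≤ ‖m.vrel t‖ * (6 * K) := by gcongr
    rw [div_le_iff₀ (by positivity)]
    rw [one_div_mul_eq_div, div_le_iff₀ hK] at h2
    linarith only [h2]
  have hvsq : (1 / (2 * K ^ 2)) ^ 2 ≤ ‖m.vrel t‖ ^ 2 := by gcongr
  have hvup : ‖m.vrel t‖ ^ 2 ≤ 28 * K := by
    have h1 : ‖m.vrel t‖ ≤ ‖m.v₃ t‖ + ‖m.v₄ t‖ := norm_sub_le _ _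
    exact le_trans (by gcongr) hsumsq
  have hE : m.relEnergy μ t = ‖m.vrel t‖ ^ 2 / 4 - μ / ρ := by
    rw [relEnergy_eq, keplerEnergy, ← hsep]; rfl
  have heK : (1 / (2 * K ^ 2)) ^ 2 = 16 * energyMin K := by
    rw [energyMin]; field_simp; norm_num
  have heK1 : energyMin K ≤ K := by
    rw [energyMin, div_le_iff₀ (by positivity)]
    have : 1 ≤ K ^ 4 := one_le_pow₀ hK1
    nlinarith only [this, hK1]
  have hratio := hsm.ratio_le
  have he0 := energyMin_pos hK
  refine ⟨?_, ?_, (norm_add_le _ _).trans hsum⟩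
  · rw [hE]; linarith only [heK, hvsq, hratio, he0]
  · rw [hE, energyMax]; linarith only [hvup, hmr, heK1]

theorem IsSolution.mono (h : m.IsSolution μ χ a b) (htb : t ≤ b) : m.IsSolution μ χ a t := by
  have hs : Icc a t ⊆ Icc a b := Icc_subset_Icc_right htb
  exact ⟨fun s hs' => h.ne₃₁ s (hs hs'), fun s hs' => h.ne₃₂ s (hs hs'),
    fun s hs' => h.ne₄₁ s (hs hs'), fun s hs' => h.ne₄₂ s (hs hs'),
    fun s hs' => h.ne₃₄ s (hs hs'), fun s hs' => (h.deriv_Q₃ s (hs hs')).mono hs,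
    fun s hs' => (h.deriv_Q₄ s (hs hs')).mono hs, fun s hs' => (h.deriv_v₃ s (hs hs')).mono hs,
    fun s hs' => (h.deriv_v₄ s (hs hs')).mono hs⟩

theorem IsInnerArc.mono (h : m.IsInnerArc κ K μ χ a b) (ht : t ∈ Icc a b) :
    m.IsInnerArc κ K μ χ a t :=
  ⟨ht.1, h.solution.mono ht.2, h.admissible, h.start,
    fun s hs => h.inside s ⟨hs.1, hs.2.trans ht.2⟩⟩

theorem IsSolution.hasDerivWithinAt_diff (h : m.IsSolution μ χ a b) (ht : t ∈ Icc a b) :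
    HasDerivWithinAt m.diff (m.vrel t) (Icc a b) t :=
  (h.deriv_Q₃ t ht).sub (h.deriv_Q₄ t ht)

theorem IsSolution.hasDerivWithinAt_vrel (h : m.IsSolution μ χ a b) (ht : t ∈ Icc a b) :
    HasDerivWithinAt m.vrel (-((2 * μ * (‖m.diff t‖ ^ 3)⁻¹) • m.diff t)
      + (centerField χ (m.Q₃ t) - centerField χ (m.Q₄ t))) (Icc a b) t := by
  refine ((h.deriv_v₃ t ht).sub (h.deriv_v₄ t ht)).congr_deriv ?_
  have h1 : attraction (m.Q₄ t) (m.Q₃ t) = (‖m.diff t‖ ^ 3)⁻¹ • m.diff t := rfl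
  rw [attraction_comm (m.Q₃ t) (m.Q₄ t), h1, centerField, centerField]
  module

/-- The mutual attraction cancels in the motion of the centre of mass. -/
theorem IsSolution.hasDerivWithinAt_velocity_sum (h : m.IsSolution μ χ a b) (ht : t ∈ Icc a b) :
    HasDerivWithinAt (fun t => m.v₃ t + m.v₄ t)
      (centerField χ (m.Q₃ t) + centerField χ (m.Q₄ t)) (Icc a b) t := by
  refine ((h.deriv_v₃ t ht).add (h.deriv_v₄ t ht)).congr_deriv ?_
  rw [attraction_comm (m.Q₄ t) (m.Q₃ t), centerField, centerField]
  module

theorem IsSolution.diff_ne_zero (h : m.IsSolution μ χ a b) (ht : t ∈ Icc a b) : m.diff t ≠ 0 :=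
  sub_ne_zero.2 (h.ne₃₄ t ht)

/-- As long as the centre of mass has moved little, both particles stay in a region where the force
of the fixed centres is bounded and Lipschitz. -/
theorem IsInnerArc.position_bounds (h : m.IsInnerArc κ K μ χ a b) (hK : 0 < K)
    (hsm : IsSmall K μ (μ ^ κ)) (ht : t ∈ Icc a b)
    (hP : ‖(m.Q₃ t + m.Q₄ t) - (m.Q₃ a + m.Q₄ a)‖ * (4 * K) ≤ 1) :
    (1 / (2 * K) ≤ ‖m.Q₃ t‖ ∧ ‖m.Q₃ t‖ ≤ K + 1) ∧
      (1 / (2 * K) ≤ ‖m.Q₄ t‖ ∧ ‖m.Q₄ t‖ ≤ K + 1) := by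
  have hK1 := h.admissible.one_le hK
  have hQ := h.admissible.norm_le hK
  have hQ' := h.admissible.far_from_center
  have hKhalf : 1 / K = 2 * (1 / (2 * K)) := by field_simp
  have hpos : 0 < 1 / (2 * K) := by positivity
  have hle1 : 1 / (2 * K) ≤ 1 := by rw [div_le_one (by positivity)]; linarith
  have hρ : μ ^ κ ≤ 1 / (2 * K) / 4 := by
    rw [div_div, le_div_iff₀ (by positivity)]; linarith [hsm.radius]
  have hP' : ‖(m.Q₃ t + m.Q₄ t) - (m.Q₃ a + m.Q₄ a)‖ ≤ 1 / (2 * K) / 2 := by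
    rw [div_div, le_div_iff₀ (by positivity)]; linarith
  have hra : ‖m.Q₃ a - m.Q₄ a‖ = μ ^ κ := h.start
  have hrt : ‖m.Q₃ t - m.Q₄ t‖ ≤ μ ^ κ := h.inside t ht
  have key : ∀ q : Plane, ‖q - m.Q₃ a‖ ≤ 1 / (2 * K) → 1 / (2 * K) ≤ ‖q‖ ∧ ‖q‖ ≤ K + 1 := by
    intro q hq
    have h1 := abs_le.1 ((abs_norm_sub_norm_le q (m.Q₃ a)).trans hq)
    constructor <;> linarith
  have hhalf : ∀ y : Plane, ‖(1 / 2 : ℝ) • y‖ = ‖y‖ / 2 := fun y => by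
    rw [norm_smul, norm_eq_abs, abs_of_pos one_half_pos]; ring
  constructor
  · refine key _ ?_
    have h1 : m.Q₃ t - m.Q₃ a = (1 / 2 : ℝ) • ((m.Q₃ t + m.Q₄ t) - (m.Q₃ a + m.Q₄ a))
        + (1 / 2 : ℝ) • (m.Q₃ t - m.Q₄ t) - (1 / 2 : ℝ) • (m.Q₃ a - m.Q₄ a) := by module
    rw [h1]
    refine (norm_sub_le _ _).trans ?_
    have := norm_add_le ((1 / 2 : ℝ) • ((m.Q₃ t + m.Q₄ t) - (m.Q₃ a + m.Q₄ a)))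
      ((1 / 2 : ℝ) • (m.Q₃ t - m.Q₄ t))
    rw [hhalf, hhalf] at this
    rw [hhalf]
    linarith
  · refine key _ ?_
    have h1 : m.Q₄ t - m.Q₃ a = (1 / 2 : ℝ) • ((m.Q₃ t + m.Q₄ t) - (m.Q₃ a + m.Q₄ a))
        - (1 / 2 : ℝ) • (m.Q₃ t - m.Q₄ t) - (1 / 2 : ℝ) • (m.Q₃ a - m.Q₄ a) := by module
    rw [h1]
    refine (norm_sub_le _ _).trans ?_
    have := norm_sub_le ((1 / 2 : ℝ) • ((m.Q₃ t + m.Q₄ t) - (m.Q₃ a + m.Q₄ a)))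
      ((1 / 2 : ℝ) • (m.Q₃ t - m.Q₄ t))
    rw [hhalf, hhalf] at this
    rw [hhalf]
    linarith

/-- The continuation hypothesis, normalized to `excursion ≤ 1`: how far the centre of mass and the
relative energy have moved since the time `a`. -/
noncomputable def excursion (m : Motion) (K μ a t : ℝ) : ℝ :=
  max (‖(m.Q₃ t + m.Q₄ t) - (m.Q₃ a + m.Q₄ a)‖ * (4 * K))
    (|m.relEnergy μ t - m.relEnergy μ a| / energyMin K)

theorem IsInnerArc.perturbedKepler_of_excursion_le (h : m.IsInnerArc κ K μ χ a b) (hK : 0 < K)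
    (hsm : IsSmall K μ (μ ^ κ)) (hχ : K + 2 ≤ χ)
    (hex : ∀ t ∈ Icc a b, m.excursion K μ a t ≤ 1) :
    PerturbedKepler μ (fieldLip K) (μ ^ κ) (energyMin K) (energyMax K) a b m.diff m.vrel
      (fun t => centerField χ (m.Q₃ t) - centerField χ (m.Q₄ t)) where
  μ_pos := hsm.μ_pos
  μ_le := (div_le_one hsm.ρ_pos).1 hsm.ratio_le_one
  L_nonneg := (fieldLip_pos hK).le
  e₀_pos := energyMin_pos hK
  small := by
    have h1 := hsm.lip
    have h2 := hsm.ρ_le_one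
    have h3 := hsm.ρ_pos
    have h4 := fieldLip_pos hK
    nlinarith [mul_pos h4 h3]
  le := h.le
  ne_zero t ht := h.solution.diff_ne_zero ht
  inside := h.inside
  start := h.start
  deriv_x t ht := h.solution.hasDerivWithinAt_diff ht
  deriv_v t ht := h.solution.hasDerivWithinAt_vrel ht
  perturbation t ht := by
    obtain ⟨⟨h1, h2⟩, h3, h4⟩ := h.position_bounds hK hsm ht ((le_max_left _ _).trans (hex t ht))
    exact norm_centerField_sub_le hK hχ h1 h2 h3 h4
  energy t ht := by
    have h1 := (le_max_right _ _).trans (hex t ht)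
    rw [div_le_one (energyMin_pos hK)] at h1
    have h2 := abs_le.1 h1
    obtain ⟨h3, h4, -⟩ := h.admissible.initial_bounds hK hsm hχ h.start
    rw [← relEnergy_eq]
    constructor <;> linarith

/-- The total velocity is at most `6 K` at the start, and changes by at most `10 K ^ 2` per unit of
time; as the arc lasts less than a unit of time, it never exceeds `16 K ^ 2`. -/
theorem IsInnerArc.sum_sub_le_of_excursion_le (h : m.IsInnerArc κ K μ χ a b) (hK : 0 < K)
    (hsm : IsSmall K μ (μ ^ κ)) (hχ : K + 2 ≤ χ)
    (hex : ∀ t ∈ Icc a b, m.excursion K μ a t ≤ 1) (ht : t ∈ Icc a b) :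
    ‖(m.v₃ t + m.v₄ t) - (m.v₃ a + m.v₄ a)‖ ≤ 10 * K ^ 2 * (timeConst K * μ ^ κ) ∧
      ‖(m.Q₃ t + m.Q₄ t) - (m.Q₃ a + m.Q₄ a)‖ ≤ 16 * K ^ 2 * (timeConst K * μ ^ κ) := by
  have hK1 := h.admissible.one_le hK
  have ha : a ∈ Icc a b := left_mem_Icc.2 h.le
  have hT : b - a ≤ timeConst K * μ ^ κ :=
    (h.perturbedKepler_of_excursion_le hK hsm hχ hex).duration_le
  have hF : ∀ t ∈ Icc a b, ‖centerField χ (m.Q₃ t) + centerField χ (m.Q₄ t)‖ ≤ 10 * K ^ 2 := by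
    intro t ht
    obtain ⟨⟨h1, h2⟩, h3, h4⟩ := h.position_bounds hK hsm ht ((le_max_left _ _).trans (hex t ht))
    refine (norm_add_le _ _).trans ?_
    linarith [norm_centerField_le hK1 hχ h1 h2, norm_centerField_le hK1 hχ h3 h4]
  have hV : ∀ t ∈ Icc a b, ‖(m.v₃ t + m.v₄ t) - (m.v₃ a + m.v₄ a)‖
      ≤ 10 * K ^ 2 * (timeConst K * μ ^ κ) := fun t ht =>
    norm_sub_le_of_hasDerivWithinAt (fun t ht => h.solution.hasDerivWithinAt_velocity_sum ht)
      hF hT ha ht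
  refine ⟨hV t ht, norm_sub_le_of_hasDerivWithinAt (f := fun t => m.Q₃ t + m.Q₄ t)
    (fun t ht => (h.solution.deriv_Q₃ t ht).add (h.solution.deriv_Q₄ t ht)) (fun t ht => ?_)
    hT ha ht⟩
  obtain ⟨-, -, h3⟩ := h.admissible.initial_bounds hK hsm hχ h.start
  have h4 := norm_le_norm_add_norm_sub (m.v₃ a + m.v₄ a) (m.v₃ t + m.v₄ t)
  rw [norm_sub_rev] at h4
  have h5 := hV t ht
  have h6 := hsm.time
  nlinarith [sq_nonneg K]

/-- On an inner arc the centre of mass and the relative energy move so little that the continuation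
hypothesis never fails. -/
theorem IsInnerArc.excursion_le (h : m.IsInnerArc κ K μ χ a b) (hK : 0 < K)
    (hsm : IsSmall K μ (μ ^ κ)) (hχ : K + 2 ≤ χ) :
    ∀ t ∈ Icc a b, m.excursion K μ a t ≤ 1 := by
  have hE : ContinuousOn (m.relEnergy μ) (Icc a b) := by
    have h1 : ContinuousOn (fun t => keplerEnergy μ (m.diff t) (m.vrel t)) (Icc a b) := by
      have hx : ContinuousOn m.diff (Icc a b) := fun t ht =>
        (h.solution.hasDerivWithinAt_diff ht).continuousWithinAt
      have hv : ContinuousOn m.vrel (Icc a b) := fun t ht =>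
        (h.solution.hasDerivWithinAt_vrel ht).continuousWithinAt
      exact ((hv.norm.pow 2).div_const 4).sub (continuousOn_const.div hx.norm
        fun t ht => norm_ne_zero_iff.2 (h.solution.diff_ne_zero ht))
    exact h1.congr fun t _ => relEnergy_eq m μ t
  have hQ : ContinuousOn (fun t => m.Q₃ t + m.Q₄ t) (Icc a b) := fun t ht =>
    ((h.solution.deriv_Q₃ t ht).add (h.solution.deriv_Q₄ t ht)).continuousWithinAt
  have hcont : ContinuousOn (m.excursion K μ a) (Icc a b) :=
    (((hQ.sub continuousOn_const).norm).mul continuousOn_const).sup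
      (((hE.sub continuousOn_const).abs).div_const _)
  refine fun t ht => (lt_of_bootstrap hcont (by simp [excursion]) (fun t ht hex => ?_) t ht).le
  have h' := h.mono ht
  have htI : t ∈ Icc a t := right_mem_Icc.2 ht.1
  have hP := h'.perturbedKepler_of_excursion_le hK hsm hχ hex
  have h1 := (h'.sum_sub_le_of_excursion_le hK hsm hχ hex htI).2
  have h2 := hP.abs_energy_sub_le (left_mem_Icc.2 ht.1) htI
  refine max_lt ?_ ?_
  · calc _ ≤ 16 * K ^ 2 * (timeConst K * μ ^ κ) * (4 * K) := by gcongr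
      _ = 16 * K ^ 2 * timeConst K * (4 * K) * μ ^ κ := by ring
      _ < 1 := hsm.drift
  · rw [div_lt_one (energyMin_pos hK), relEnergy_eq, relEnergy_eq]
    refine h2.trans_lt (lt_of_le_of_lt ?_ hsm.energy)
    have := fieldLip_pos hK
    have := energyMin_pos hK
    gcongr
    exact pow_le_of_le_one hsm.ρ_pos.le hsm.ρ_le_one two_ne_zero

/-- The relative motion along an inner arc is a perturbed Kepler motion with uniform constants. -/
theorem IsInnerArc.perturbedKepler (h : m.IsInnerArc κ K μ χ a b) (hK : 0 < K)
    (hsm : IsSmall K μ (μ ^ κ)) (hχ : K + 2 ≤ χ) :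
    PerturbedKepler μ (fieldLip K) (μ ^ κ) (energyMin K) (energyMax K) a b m.diff m.vrel
      (fun t => centerField χ (m.Q₃ t) - centerField χ (m.Q₄ t)) :=
  h.perturbedKepler_of_excursion_le hK hsm hχ (h.excursion_le hK hsm hχ)

theorem IsInnerArc.sum_sub_le (h : m.IsInnerArc κ K μ χ a b) (hK : 0 < K)
    (hsm : IsSmall K μ (μ ^ κ)) (hχ : K + 2 ≤ χ) (ht : t ∈ Icc a b) :
    ‖(m.v₃ t + m.v₄ t) - (m.v₃ a + m.v₄ a)‖ ≤ 10 * K ^ 2 * (timeConst K * μ ^ κ) ∧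
      ‖(m.Q₃ t + m.Q₄ t) - (m.Q₃ a + m.Q₄ a)‖ ≤ 16 * K ^ 2 * (timeConst K * μ ^ κ) :=
  h.sum_sub_le_of_excursion_le hK hsm hχ (h.excursion_le hK hsm hχ) ht

end Motion

/-! ### The size of `μ` and the range of the scattering angle -/

/-- The exponents that occur are positive because `1 / 3 < κ < 1`. -/
theorem exists_forall_rpow_le {κ : ℝ} (hκ : 1 / 3 < κ) (hκ' : κ < 1 / 2) {c : ℝ} (hc : 0 < c) :
    ∃ μ₀ > 0, ∀ μ : ℝ, 0 < μ → μ < μ₀ →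
      μ ≤ 1 ∧ μ ^ κ ≤ c ∧ μ ^ (1 - κ) ≤ c ∧ μ ^ (3 * κ - 1) ≤ c := by
  have key : ∀ p : ℝ, 0 < p → ∀ᶠ μ in nhdsWithin (0 : ℝ) (Ioi 0), μ ^ p < c := by
    intro p hp
    have : Filter.Tendsto (fun μ : ℝ => μ ^ p) (nhdsWithin 0 (Ioi 0)) (nhds ((0 : ℝ) ^ p)) :=
      ((continuous_id.rpow_const fun _ => Or.inr hp.le).tendsto 0).mono_left nhdsWithin_le_nhds
    exact this.eventually_lt_const (by rwa [zero_rpow hp.ne'])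
  have h1 : ∀ᶠ μ in nhdsWithin (0 : ℝ) (Ioi 0), μ < 1 :=
    nhdsWithin_le_nhds (gt_mem_nhds one_pos)
  obtain ⟨μ₀, hμ₀, hsub⟩ := mem_nhdsGT_iff_exists_Ioo_subset.1 (h1.and ((key κ (by linarith)).and
    ((key (1 - κ) (by linarith)).and (key (3 * κ - 1) (by linarith)))))
  refine ⟨μ₀, hμ₀, fun μ h h' => ?_⟩
  obtain ⟨h2, h3, h4, h5⟩ := hsub ⟨h, h'⟩
  exact ⟨h2.le, h3.le, h4.le, h5.le⟩

theorem abs_arctan (u : ℝ) : |arctan u| = arctan |u| := by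
  rcases le_total 0 u with h | h
  · rw [abs_of_nonneg h, abs_of_nonneg (arctan_nonneg.2 h)]
  · rw [abs_of_nonpos h, abs_of_nonpos (arctan_zero ▸ arctan_mono h), arctan_neg]

theorem abs_le_tan_of_abs_arctan_le {u φ : ℝ} (hφ : φ < π / 2) (h : |arctan u| ≤ φ) :
    |u| ≤ tan φ := by
  rw [abs_arctan] at h
  have h0 : 0 ≤ arctan |u| := arctan_nonneg.2 (abs_nonneg u)
  rw [← tan_arctan |u|]
  exact strictMonoOn_tan.monotoneOn ⟨neg_pi_div_two_lt_arctan _, arctan_lt_pi_div_two _⟩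
    ⟨by linarith [pi_pos], hφ⟩ h

theorem tan_le_abs_of_le_abs_arctan {u φ : ℝ} (hφ : 0 ≤ φ) (h : φ ≤ |arctan u|) :
    tan φ ≤ |u| := by
  rw [abs_arctan] at h
  have h1 := arctan_lt_pi_div_two |u|
  rw [← tan_arctan |u|]
  exact strictMonoOn_tan.monotoneOn ⟨by linarith [pi_pos], by linarith⟩
    ⟨neg_pi_div_two_lt_arctan _, h1⟩ h

namespace Motion

variable {m : Motion} {κ K μ χ a b s t θ : ℝ}

theorem abs_scatterParam_le (hθ : 0 < θ) (h1 : θ ≤ m.angle μ s) (h2 : m.angle μ s ≤ 2 * π - θ) :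
    |scatterParam μ (m.diff s) (m.vrel s)| ≤ tan ((π - θ) / 2) := by
  rw [angle_eq] at h1 h2
  refine abs_le_tan_of_abs_arctan_le (by linarith) (abs_le.2 ⟨?_, ?_⟩) <;> linarith

theorem le_abs_scatterParam (hθ : 0 ≤ θ) (h : θ ≤ |m.angle μ s - π|) :
    tan (θ / 2) ≤ |scatterParam μ (m.diff s) (m.vrel s)| := by
  rw [angle_eq, add_sub_cancel_left, abs_mul, abs_two] at h
  exact tan_le_abs_of_le_abs_arctan (by linarith) (by linarith)

/-! ### Estimates for inner arcs and passages -/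

/-- The momentum of a passage splits into the relative velocity, which is rotated, and the velocity
of the centre of mass, which hardly changes. -/
theorem IsPassage.norm_velocity_sub_le (h : m.IsPassage κ K μ χ a b) (hK : 0 < K)
    (hsm : IsSmall K μ (μ ^ κ)) (hχ : K + 2 ≤ χ) {ε α : ℝ}
    (hε : ‖m.vrel b - rot α (m.vrel a)‖ ≤ ε) :
    ‖m.v₃ b - ((1 / 2 : ℝ) • rot α (m.v₃ a - m.v₄ a) + (1 / 2 : ℝ) • (m.v₃ a + m.v₄ a))‖
        ≤ 10 * K ^ 2 * (timeConst K * μ ^ κ) + ε ∧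
      ‖m.v₄ b - (-((1 / 2 : ℝ) • rot α (m.v₃ a - m.v₄ a)) + (1 / 2 : ℝ) • (m.v₃ a + m.v₄ a))‖
        ≤ 10 * K ^ 2 * (timeConst K * μ ^ κ) + ε := by
  have hV := (h.sum_sub_le hK hsm hχ (right_mem_Icc.2 h.le)).1
  have hhalf : ∀ y : Plane, ‖(1 / 2 : ℝ) • y‖ ≤ ‖y‖ := fun y => by
    rw [norm_smul, norm_eq_abs, abs_of_pos one_half_pos]; linarith [norm_nonneg y]
  constructor
  · have h1 : m.v₃ b - ((1 / 2 : ℝ) • rot α (m.v₃ a - m.v₄ a) + (1 / 2 : ℝ) • (m.v₃ a + m.v₄ a))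
        = (1 / 2 : ℝ) • ((m.v₃ b + m.v₄ b) - (m.v₃ a + m.v₄ a))
          + (1 / 2 : ℝ) • (m.vrel b - rot α (m.vrel a)) := by
      simp only [vrel]; module
    rw [h1]
    exact (norm_add_le _ _).trans (add_le_add ((hhalf _).trans hV) ((hhalf _).trans hε))
  · have h1 : m.v₄ b - (-((1 / 2 : ℝ) • rot α (m.v₃ a - m.v₄ a)) + (1 / 2 : ℝ) • (m.v₃ a + m.v₄ a))
        = (1 / 2 : ℝ) • ((m.v₃ b + m.v₄ b) - (m.v₃ a + m.v₄ a))
          - (1 / 2 : ℝ) • (m.vrel b - rot α (m.vrel a)) := by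
      simp only [vrel]; module
    rw [h1]
    exact (norm_sub_le _ _).trans (add_le_add ((hhalf _).trans hV) ((hhalf _).trans hε))

theorem exists_passage_estimates (hκ : 1 / 3 < κ) (hκ' : κ < 1 / 2) (hK : 0 < K) :
    ∃ C > 0, ∃ μ₀ > 0, ∃ χ₀ > 0, ∀ μ χ : ℝ, 0 < μ → μ < μ₀ → χ₀ < χ →
      ∀ (m : Motion) (a b : ℝ),
        (m.IsPassage κ K μ χ a b → ∀ s ∈ Icc a b,
          ‖m.v₃ b - ((1 / 2 : ℝ) • rot (m.angle μ s) (m.v₃ a - m.v₄ a)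
              + (1 / 2 : ℝ) • (m.v₃ a + m.v₄ a))‖
            ≤ C * (μ ^ ((1 - 2 * κ) / 3) + μ ^ (3 * κ - 1)) ∧
          ‖m.v₄ b - (-((1 / 2 : ℝ) • rot (m.angle μ s) (m.v₃ a - m.v₄ a))
              + (1 / 2 : ℝ) • (m.v₃ a + m.v₄ a))‖
            ≤ C * (μ ^ ((1 - 2 * κ) / 3) + μ ^ (3 * κ - 1)) ∧
          ‖(m.Q₃ b + m.Q₄ b) - (m.Q₃ a + m.Q₄ a)‖ ≤ C * μ ^ κ) ∧
        (m.IsInnerArc κ K μ χ a b →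
          (∀ s ∈ Icc a b, 0 < m.relEnergy μ s ∧ m.Lin μ s ≤ C) ∧ b - a ≤ C * μ ^ κ) := by
  obtain ⟨η, hη, hsmall⟩ := exists_isSmall hK
  obtain ⟨C₁, hC₁, hscat⟩ :=
    PerturbedKepler.exists_norm_sub_rot_le (fieldLip K) (e₀ := energyMin K) (energyMax K)
  obtain ⟨μ₀, hμ₀, hμsmall⟩ := exists_forall_rpow_le hκ hκ' hη
  have hT := timeConst_pos hK
  have he := energyMin_pos hK
  set A := 16 * K ^ 2 * timeConst K with hA
  set B := 1 / (2 * √(energyMin K)) with hB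
  have hA0 : 0 < A := by positivity
  have hB0 : 0 < B := by positivity
  refine ⟨A + C₁ + B + timeConst K, by positivity, μ₀, hμ₀, K + 2, by positivity, ?_⟩
  intro μ χ hμ hμ' hχ m a b
  obtain ⟨hμ1, hρη, hmη, -⟩ := hμsmall μ hμ hμ'
  have hratio : μ / μ ^ κ = μ ^ (1 - κ) := by rw [rpow_sub hμ, rpow_one]
  have hcube : (μ ^ κ) ^ 3 / μ = μ ^ (3 * κ - 1) := by
    rw [rpow_sub hμ, rpow_one, mul_comm, rpow_mul hμ.le]; norm_cast
  have hρ : 0 < μ ^ κ := rpow_pos_of_pos hμ κ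
  have hsm := hsmall μ (μ ^ κ) hμ hρ hρη (hratio ▸ hmη)
  refine ⟨fun h s hs => ?_, fun h => ⟨fun s hs => ?_, ?_⟩⟩
  · have hP := h.perturbedKepler hK hsm hχ.le
    have h1 := hscat hP h.lt h.finish s hs
    rw [← angle_eq, hratio, hcube] at h1
    have h2 := h.norm_velocity_sub_le hK hsm hχ.le h1
    have h3 := (h.sum_sub_le hK hsm hχ.le (right_mem_Icc.2 h.le)).2
    have h4 : μ ^ (1 - κ) ≤ μ ^ ((1 - 2 * κ) / 3) :=
      rpow_le_rpow_of_exponent_ge hμ hμ1 (by linarith)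
    have h5 : μ ^ κ ≤ μ ^ (3 * κ - 1) := rpow_le_rpow_of_exponent_ge hμ hμ1 (by linarith)
    have h6 : 0 ≤ μ ^ ((1 - 2 * κ) / 3) := rpow_nonneg hμ.le _
    have h7 : 10 * K ^ 2 * (timeConst K * μ ^ κ)
        + C₁ * (μ ^ (3 * κ - 1) + μ ^ (1 - κ))
        ≤ (A + C₁ + B + timeConst K) * (μ ^ ((1 - 2 * κ) / 3) + μ ^ (3 * κ - 1)) := by
      set p := μ ^ ((1 - 2 * κ) / 3)
      set q := μ ^ (3 * κ - 1)
      have hq : 0 ≤ q := hρ.le.trans h5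
      calc 10 * K ^ 2 * (timeConst K * μ ^ κ) + C₁ * (q + μ ^ (1 - κ))
          ≤ 16 * K ^ 2 * (timeConst K * (p + q)) + C₁ * (q + p) := by
            gcongr
            · norm_num
            · linarith
        _ = (A + C₁) * (p + q) := by rw [hA]; ring
        _ ≤ _ := mul_le_mul_of_nonneg_right (by linarith) (add_nonneg h6 hq)
    refine ⟨h2.1.trans h7, h2.2.trans h7, h3.trans ?_⟩
    calc 16 * K ^ 2 * (timeConst K * μ ^ κ) = A * μ ^ κ := by rw [hA]; ring
      _ ≤ _ := by gcongr; linarith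
  · have hP := h.perturbedKepler hK hsm hχ.le
    have h1 := hP.energy s hs
    have h2 := (hP.sqrt_energy_mem hs).1
    refine ⟨by rw [relEnergy_eq]; exact he.trans_le h1.1, ?_⟩
    have h3 : m.Lin μ s ≤ B := by
      rw [Lin, relEnergy_eq, hB]
      gcongr
    linarith
  · refine (h.perturbedKepler hK hsm hχ.le).duration_le.trans ?_
    calc (energyMax K + 2) / energyMin K * μ ^ κ = timeConst K * μ ^ κ := rfl
      _ ≤ _ := by gcongr; linarith

theorem exists_close_encounter_estimates (hκ : 1 / 3 < κ) (hκ' : κ < 1 / 2) (hK : 0 < K)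
    {θ₀ : ℝ} (hθ₀ : 0 < θ₀) :
    ∃ C > 0, ∃ δ > 0, ∃ μ₀ > 0, ∃ χ₀ > 0, ∀ μ χ : ℝ, 0 < μ → μ < μ₀ → χ₀ < χ →
      ∀ (m : Motion) (a b : ℝ), ∀ s ∈ Icc a b,
        (m.IsInnerArc κ K μ χ a b → θ₀ ≤ m.angle μ s → m.angle μ s ≤ 2 * π - θ₀ →
          ∀ t ∈ Icc a b, |m.Gin t| ≤ C * μ) ∧
        (m.IsPassage κ K μ χ a b → θ₀ ≤ m.angle μ s → m.angle μ s ≤ 2 * π - θ₀ →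
          (∃ t ∈ Icc a b, m.sep t ≤ μ / δ) ∧
          InnerProductGeometry.angle (-(m.Qrel a)) (m.vrel a) ≤ C * μ ^ (1 - κ) ∧
          InnerProductGeometry.angle (m.Qrel b) (m.vrel b) ≤ C * μ ^ (1 - κ)) ∧
        (m.IsInnerArc κ K μ χ a b → θ₀ ≤ |m.angle μ s - π| →
          ∀ t ∈ Icc a b, δ * μ ≤ m.sep t) := by
  obtain ⟨η, hη, hsmall⟩ := exists_isSmall hK
  have he0 := energyMin_pos hK
  have he1 := energyMax_pos hK
  have hL := fieldLip_pos hK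
  have hq : 0 < √(energyMin K) := sqrt_pos.2 he0
  -- the tangents below are meaningful only for angles less than a right angle
  set θ := min θ₀ 1 with hθ
  have hθpos : 0 < θ := lt_min hθ₀ one_pos
  have hθle : θ ≤ θ₀ := min_le_left _ _
  have hθ1 : θ ≤ 1 := min_le_right _ _
  set M := tan (θ / 2)
  set N := tan ((π - θ) / 2)
  have hM : 0 < M := tan_pos_of_pos_of_lt_pi_div_two (by linarith) (by linarith [pi_gt_three])
  have hN : 0 < N :=
    tan_pos_of_pos_of_lt_pi_div_two (by linarith [pi_gt_three]) (by linarith)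
  set G := fieldLip K * (energyMax K + 2) / energyMin K
  have hG : 0 < G := by positivity
  set c := N / √(energyMin K) + G
  have hc : 0 < c := by positivity
  set d := M / (2 * (energyMax K + 2))
  have hd : 0 < d := by positivity
  set δ := min (min 1 (d ^ 2 / (4 * (energyMax K + 1)))) (2 * √(energyMin K) / c)
  have hδ : 0 < δ := by positivity
  have hδ1 : δ ≤ 1 := (min_le_left _ _).trans (min_le_left _ _)
  have hδd : 4 * (energyMax K + 1) * δ ≤ d ^ 2 := by
    have : δ ≤ d ^ 2 / (4 * (energyMax K + 1)) := (min_le_left _ _).trans (min_le_right _ _)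
    rw [le_div_iff₀ (by positivity)] at this
    linarith
  have hδc : c / (2 * √(energyMin K)) ≤ 1 / δ := by
    have : δ ≤ 2 * √(energyMin K) / c := min_le_right _ _
    rw [le_div_iff₀ hc] at this
    rw [div_le_div_iff₀ (by positivity) hδ]
    linarith
  obtain ⟨μ₀, hμ₀, hμsmall⟩ := exists_forall_rpow_le hκ hκ' (lt_min hη (lt_min one_pos
    (div_pos hd hG)))
  refine ⟨c + c / √(energyMin K), by positivity, δ, hδ, μ₀, hμ₀, K + 2, by positivity, ?_⟩
  intro μ χ hμ hμ' hχ m a b s hs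
  obtain ⟨hμ1, hρη, hmη, hε⟩ := hμsmall μ hμ hμ'
  have hratio : μ / μ ^ κ = μ ^ (1 - κ) := by rw [rpow_sub hμ, rpow_one]
  have hcube : (μ ^ κ) ^ 3 / μ = μ ^ (3 * κ - 1) := by
    rw [rpow_sub hμ, rpow_one, mul_comm, rpow_mul hμ.le]; norm_cast
  have hρ : 0 < μ ^ κ := rpow_pos_of_pos hμ κ
  have hsm := hsmall μ (μ ^ κ) hμ hρ (hρη.trans (min_le_left _ _))
    (hratio ▸ hmη.trans (min_le_left _ _))
  rw [← hcube] at hε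
  have hε1 : (μ ^ κ) ^ 3 ≤ μ :=
    (div_le_one hμ).1 (hε.trans ((min_le_right _ _).trans (min_le_left _ _)))
  have hεd : G * ((μ ^ κ) ^ 3 / μ) ≤ d := by
    have := hε.trans ((min_le_right _ _).trans (min_le_right _ _))
    rwa [le_div_iff₀ hG, mul_comm] at this
  have hcross : m.IsInnerArc κ K μ χ a b → θ₀ ≤ m.angle μ s → m.angle μ s ≤ 2 * π - θ₀ →
      ∀ t ∈ Icc a b, |cross (m.diff t) (m.vrel t)| ≤ c * μ := fun h h1 h2 t ht =>
    (h.perturbedKepler hK hsm hχ.le).abs_cross_le_of_scatterParam_le hε1 hs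
      (abs_scatterParam_le hθpos (hθle.trans h1) (by linarith)) ht
  refine ⟨fun h h1 h2 t ht => ?_, fun h h1 h2 => ?_, fun h h1 t ht => ?_⟩
  · have h3 := hcross h h1 h2 t ht
    rw [Gin_eq, abs_mul, abs_neg, abs_of_pos one_half_pos, add_mul]
    have h4 : 0 ≤ c / √(energyMin K) * μ := by positivity
    have h5 := abs_nonneg (cross (m.diff t) (m.vrel t))
    linarith
  · have hP := h.perturbedKepler hK hsm hχ.le
    have h3 := hcross h.toIsInnerArc h1 h2
    have haI : a ∈ Icc a b := left_mem_Icc.2 h.le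
    have hbI : b ∈ Icc a b := right_mem_Icc.2 h.le
    have hangle : c * μ / (√(energyMin K) * μ ^ κ)
        ≤ (c + c / √(energyMin K)) * μ ^ (1 - κ) := by
      rw [← hratio]
      calc c * μ / (√(energyMin K) * μ ^ κ) = c / √(energyMin K) * (μ / μ ^ κ) := by field_simp
        _ ≤ _ := by gcongr; linarith
    refine ⟨?_, ?_, ?_⟩
    · obtain ⟨t, ht, h4⟩ := hP.exists_norm_le_of_abs_cross_le h.lt h.finish h3
      refine ⟨t, ht, h4.trans ?_⟩
      calc c * μ / (2 * √(energyMin K)) = c / (2 * √(energyMin K)) * μ := by ring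
        _ ≤ 1 / δ * μ := by gcongr
        _ = μ / δ := by ring
    · have h4 := hP.angle_le_of_abs_cross_le haI h.start (h3 a haI) (σ := -1) (by simp)
        (by linarith [hP.inner_start_neg h.lt h.finish])
      have h5 : -(m.Qrel a) = (1 / 2 : ℝ) • ((-1 : ℝ) • m.diff a) := by rw [Qrel_eq]; module
      rw [h5, InnerProductGeometry.angle_smul_left_of_pos _ _ one_half_pos]
      exact h4.trans hangle
    · have h4 := hP.angle_le_of_abs_cross_le hbI h.finish (h3 b hbI) (σ := 1) (by simp)
        (by linarith [hP.inner_finish_pos h.lt h.finish])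
      rw [one_smul] at h4
      rw [Qrel_eq, InnerProductGeometry.angle_smul_left_of_pos _ _ one_half_pos]
      exact h4.trans hangle
  · exact (h.perturbedKepler hK hsm hχ.le).le_norm_of_le_scatterParam hεd hM hδ1 hδd hs
      (le_abs_scatterParam hθpos.le (hθle.trans h1)) ht

end Motion

end TwoCenterTwoBody

theorem mainTheorem8 (κ : ℝ) (hκ : 1 / 3 < κ) (hκ' : κ < 1 / 2) (K : ℝ) (hK : 0 < K) :
    (∃ C > 0, ∃ μ₀ > 0, ∃ χ₀ > 0, ∀ μ χ : ℝ, 0 < μ → μ < μ₀ → χ₀ < χ →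
      ∀ (m : Motion) (a b : ℝ),
        -- (a) the encounter is nearly an elastic collision
        (m.IsPassage κ K μ χ a b → ∀ s ∈ Icc a b,
          ‖m.v₃ b - ((1 / 2 : ℝ) • rot (m.angle μ s) (m.v₃ a - m.v₄ a)
              + (1 / 2 : ℝ) • (m.v₃ a + m.v₄ a))‖
            ≤ C * (μ ^ ((1 - 2 * κ) / 3) + μ ^ (3 * κ - 1)) ∧
          ‖m.v₄ b - (-((1 / 2 : ℝ) • rot (m.angle μ s) (m.v₃ a - m.v₄ a))
              + (1 / 2 : ℝ) • (m.v₃ a + m.v₄ a))‖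
            ≤ C * (μ ^ ((1 - 2 * κ) / 3) + μ ^ (3 * κ - 1)) ∧
          ‖(m.Q₃ b + m.Q₄ b) - (m.Q₃ a + m.Q₄ a)‖ ≤ C * μ ^ κ) ∧
        (m.IsInnerArc κ K μ χ a b →
          -- (b), first claim
          (∀ s ∈ Icc a b, 0 < m.relEnergy μ s ∧ m.Lin μ s ≤ C) ∧
          -- (d) passage time
          b - a ≤ C * μ ^ κ)) ∧
    (∀ θ₀ > 0, ∃ C > 0, ∃ δ > 0, ∃ μ₀ > 0, ∃ χ₀ > 0, ∀ μ χ : ℝ, 0 < μ → μ < μ₀ → χ₀ < χ →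
      ∀ (m : Motion) (a b : ℝ), ∀ s ∈ Icc a b,
        -- (b) angle bounded away from `0` and `2 π`: angular momentum and closest distance
        (m.IsInnerArc κ K μ χ a b → θ₀ ≤ m.angle μ s → m.angle μ s ≤ 2 * π - θ₀ →
          ∀ t ∈ Icc a b, |m.Gin t| ≤ C * μ) ∧
        (m.IsPassage κ K μ χ a b → θ₀ ≤ m.angle μ s → m.angle μ s ≤ 2 * π - θ₀ →
          (∃ t ∈ Icc a b, m.sep t ≤ μ / δ) ∧
          -- (c) alignment on entering and on leaving
          InnerProductGeometry.angle (-(m.Qrel a)) (m.vrel a) ≤ C * μ ^ (1 - κ) ∧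
          InnerProductGeometry.angle (m.Qrel b) (m.vrel b) ≤ C * μ ^ (1 - κ)) ∧
        -- (b) angle bounded away from `π`: the particles stay apart
        (m.IsInnerArc κ K μ χ a b → θ₀ ≤ |m.angle μ s - π| →
          ∀ t ∈ Icc a b, δ * μ ≤ m.sep t)) :=
  ⟨Motion.exists_passage_estimates hκ hκ' hK,
    fun _ hθ₀ => Motion.exists_close_encounter_estimates hκ hκ' hK hθ₀⟩
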